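/- For $\nu\ge 0$ and $x>0$ let $J_\nu(x)=\sum_{m\ge 0}\frac{(-1)^m}{m!\,\Gamma(m+\nu+1)}\left(\frac{x}{2}\right)^{2m+\nu}$ be the Bessel function of the first kind, and for $\delta\in\mathbb{R}$ with $|\delta|\le\nu$ put $j_{\nu,\delta}(x)=x^{-\delta}J_\nu(x)$. Theorem. The positive zeros of the derivative $j_{\nu,\delta}'$ form an infinite increasing sequence $(a'_{\nu,\delta,k})_{k\ge k_0}$ containing every positive zero exactly once, where the indexing begins with $k_0=1$ if $\nu=\delta$ and with $k_0=0$ otherwise. For every fixed $\nu\ge 0$ there are constants $C$ and $K$, depending only on $\nu$, such that for every real $\delta$ with $|\delta|\le\nu$ and every integer $k\ge K$, $$\left|a'_{\nu,\delta,k}-\pi\left(k+\frac{\nu}{2}+\frac14\right)\right|\le \frac{C}{k}.$$ That is, $a'_{\nu,\delta,k}=\pi\left(k+\frac{\nu}{2}+\frac14\right)+O_\nu\left(\frac1k\right)$ for fixed $\nu\ge|\delta|$ and large $k$. -/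

import Mathlib

namespace UltraBessel

/-- The Bessel function of the first kind `J_ν(x)` (for `x > 0` and real order `ν ≥ 0`), given by
its power series `∑ (-1)^m / (m! Γ(m + ν + 1)) (x/2)^(2m + ν)`. -/
noncomputable def besselJ (ν x : ℝ) : ℝ :=
  ∑' m : ℕ, (-1 : ℝ) ^ m / ((m.factorial : ℝ) * Real.Gamma ((m : ℝ) + ν + 1))
    * (x / 2) ^ (2 * (m : ℝ) + ν)

/-- The function `j_{ν,δ}(x) = x^(-δ) J_ν(x)`, for `x > 0`. -/
noncomputable def ultraJ (ν δ x : ℝ) : ℝ := x ^ (-δ) * besselJ ν x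

/-- The set of positive zeros of the derivative `j'_{ν,δ}`. -/
def derivZeros (ν δ : ℝ) : Set ℝ := {x : ℝ | 0 < x ∧ deriv (ultraJ ν δ) x = 0}

/-- The elements of a set of reals listed in increasing order: the smallest one, then each time
the smallest one that exceeds its predecessor. -/
noncomputable def increasingList (S : Set ℝ) : ℕ → ℝ
  | 0 => sInf S
  | n + 1 => sInf {x : ℝ | x ∈ S ∧ increasingList S n < x}

/-- The index of the smallest positive zero of `j'_{ν,δ}`: it is `1` if `ν = δ` (this is where
`j'_{ν,δ}(x) = -x^(-ν) J_{ν+1}(x)`), and `0` otherwise. -/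
noncomputable def firstIndex (ν δ : ℝ) : ℕ := open Classical in if ν = δ then 1 else 0

/-- The zero `a'_{ν,δ,k}`, for `k ≥ firstIndex ν δ`: the positive zeros of `j'_{ν,δ}` in increasing
order, with the indices beginning at `firstIndex ν δ`. -/
noncomputable def aPrime (ν δ : ℝ) (k : ℕ) : ℝ :=
  increasingList (derivZeros ν δ) (k - firstIndex ν δ)

end UltraBessel

namespace UltraBessel
open Filter Topology Set MeasureTheory

/-! Put g(x) = (x/2)^(-ν) J_ν(x), an even entire function. A positive x is a zero of j_{ν,δ}'
exactly when x g' + (ν - δ) g = 0, that is, when the vector (-x g', g) has angle arctan(ν - δ)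
modulo π. By Lommel's inequality (`lommel_pos`) the continuous angle ψ of this vector increases
strictly from ψ(0) = 0, and it tends to infinity. So each level arctan(ν - δ) + kπ with k ≥ 0 is
reached once. The level 0 is reached only at x = 0, which is why the indices start at 1 when δ = ν.

To locate the zeros, take the Prüfer angle θ of u = √x J_ν. The equation u'' + (1 - (ν² - 1/4)/x²) u
= 0 gives θ' = 1 + O(1/x²), hence θ = x + c + O(1/x). The angles θ and ψ + π/2 stay less than π
apart and their sines have the same sign, so at the zero of index k the angle θ lies in (kπ,
(k+1)π). There u'/u = (δ + 1/2)/x, which puts θ within (ν + 1/2)/x of kπ + π/2 (`abs_zero_sub_le`).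
Both ψ and θ depend on ν alone, whence the uniformity in δ.

It remains to see that c = π/4 - πν/2. Modulo π this comes from the Laplace transform of x^ν J_ν, a
real multiple of (1 + s²)^(-ν - 1/2): an Abelian theorem at s = i reads off the phase
(`IsPruferPhase.sin_limit_eq_zero`). The remaining multiple of π is the same for ν and ν + 1, and
the monotonicity of θ - x bounds it from below for ν ≤ 1/2 and from above for ν in [1/2, 3/2]; so it
is zero (`HasPhaseShift.eq_zero`). -/

/-! ### Power series, recurrence and differential equation -/

/-- The entire function `∑ (-1)^m y^m / (m! Γ(m + ν + 1))`. -/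
noncomputable def besselClifford (ν y : ℝ) : ℝ :=
  ∑' m : ℕ, (-1 : ℝ) ^ m / ((m.factorial : ℝ) * Real.Gamma ((m : ℝ) + ν + 1)) * y ^ m

/-- The even entire function `(x/2)^(-ν) J_ν(x)`. -/
noncomputable def besselEntire (ν x : ℝ) : ℝ := besselClifford ν ((x / 2) ^ 2)

lemma Gamma_nat_add_pos {ν : ℝ} (hν : -1 < ν) (m : ℕ) : 0 < Real.Gamma ((m : ℝ) + ν + 1) := by
  apply Real.Gamma_pos_of_pos
  have : (0 : ℝ) ≤ m := m.cast_nonneg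
  linarith

lemma exists_pos_le_Gamma_nat_add {ν : ℝ} (hν : -1 < ν) :
    ∃ κ : ℝ, 0 < κ ∧ ∀ m : ℕ, κ ≤ Real.Gamma ((m : ℝ) + ν + 1) := by
  have h0 := Gamma_nat_add_pos hν 0
  have h1 := Gamma_nat_add_pos hν 1
  -- The step from m = 0 to m = 1 multiplies by ν + 1, which may be less than 1; every later factor
  -- is at least 1. Hence the minimum of the first two values.
  refine ⟨min (Real.Gamma (((0 : ℕ) : ℝ) + ν + 1)) (Real.Gamma (((1 : ℕ) : ℝ) + ν + 1)),
    lt_min h0 h1, fun m ↦ ?_⟩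
  rcases m with _ | m
  · exact min_le_left _ _
  · induction m with
    | zero => exact min_le_right _ _
    | succ m ih =>
      refine ih.trans ?_
      have hm : (0 : ℝ) ≤ m := m.cast_nonneg
      have hpos := Gamma_nat_add_pos hν (m + 1)
      have : ((m + 1 + 1 : ℕ) : ℝ) + ν + 1 = (((m + 1 : ℕ) : ℝ) + ν + 1) + 1 := by
        push_cast; ring
      rw [this, Real.Gamma_add_one (s := ((m + 1 : ℕ) : ℝ) + ν + 1) (by push_cast; linarith)]
      refine le_mul_of_one_le_left hpos.le ?_
      push_cast
      linarith

lemma abs_besselClifford_coeff_le {ν κ : ℝ} (hκ : 0 < κ) {m : ℕ}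
    (h : κ ≤ Real.Gamma ((m : ℝ) + ν + 1)) :
    |(-1 : ℝ) ^ m / ((m.factorial : ℝ) * Real.Gamma ((m : ℝ) + ν + 1))|
      ≤ κ⁻¹ * (1 / m.factorial) := by
  have hf : (0 : ℝ) < m.factorial := by exact_mod_cast m.factorial_pos
  have hG := hκ.trans_le h
  rw [abs_div, abs_pow, abs_neg, abs_one, one_pow, abs_of_pos (by positivity),
    inv_mul_eq_div, div_div, mul_comm (m.factorial : ℝ)]
  rw [mul_comm (m.factorial : ℝ)]
  gcongr

lemma summable_besselClifford {ν : ℝ} (hν : -1 < ν) (y : ℝ) :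
    Summable fun m : ℕ ↦
      (-1 : ℝ) ^ m / ((m.factorial : ℝ) * Real.Gamma ((m : ℝ) + ν + 1)) * y ^ m := by
  obtain ⟨κ, hκ, h⟩ := exists_pos_le_Gamma_nat_add hν
  refine Summable.of_norm_bounded ((Real.summable_pow_div_factorial |y|).mul_left κ⁻¹) fun m ↦ ?_
  rw [norm_mul, norm_pow, Real.norm_eq_abs, Real.norm_eq_abs]
  calc _ ≤ κ⁻¹ * (1 / m.factorial) * |y| ^ m := by
        gcongr; exact abs_besselClifford_coeff_le hκ (h m)
    _ = _ := by ring

lemma hasDerivAt_besselClifford {ν : ℝ} (hν : -1 < ν) (y : ℝ) :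
    HasDerivAt (besselClifford ν) (-besselClifford (ν + 1) y) y := by
  obtain ⟨κ, hκ, h⟩ := exists_pos_le_Gamma_nat_add hν
  set R : ℝ := |y| + 1
  have hR : 0 < R := by positivity
  set u : ℕ → ℝ := fun m ↦ κ⁻¹ * (1 / m.factorial) * (m * R ^ (m - 1))
  have hu : Summable u := by
    rw [← summable_nat_add_iff 1]
    refine ((Real.summable_pow_div_factorial R).mul_left κ⁻¹).congr fun m ↦ ?_
    simp only [u, Nat.factorial_succ, Nat.add_sub_cancel]
    push_cast
    field_simp
  have hmem : y ∈ Metric.ball (0 : ℝ) R := by simp [R]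
  have key := hasDerivAt_tsum_of_isPreconnected
    (g := fun (m : ℕ) (y : ℝ) ↦
      (-1 : ℝ) ^ m / ((m.factorial : ℝ) * Real.Gamma ((m : ℝ) + ν + 1)) * y ^ m)
    (g' := fun (m : ℕ) (y : ℝ) ↦
      (-1 : ℝ) ^ m / ((m.factorial : ℝ) * Real.Gamma ((m : ℝ) + ν + 1)) * (m * y ^ (m - 1)))
    (t := Metric.ball 0 R) (y₀ := y) (y := y) hu Metric.isOpen_ball
    (convex_ball (0 : ℝ) R).isPreconnected
    (fun m z _ ↦ (hasDerivAt_pow m z).const_mul _)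
    (fun m z hz ↦ by
      rw [norm_mul, norm_mul, norm_pow, Real.norm_eq_abs, Real.norm_eq_abs, Real.norm_eq_abs,
        Nat.abs_cast]
      have hz' : |z| ≤ R := by simpa using (Metric.mem_ball.mp hz).le
      simp only [u]
      gcongr
      exact abs_besselClifford_coeff_le hκ (h m))
    hmem (summable_besselClifford hν y) hmem
  refine key.congr_deriv ?_
  have hs : Summable fun m : ℕ ↦
      (-1 : ℝ) ^ m / ((m.factorial : ℝ) * Real.Gamma ((m : ℝ) + ν + 1)) * (m * y ^ (m - 1)) := by
    refine Summable.of_norm_bounded hu fun m ↦ ?_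
    rw [norm_mul, norm_mul, norm_pow, Real.norm_eq_abs, Real.norm_eq_abs, Real.norm_eq_abs,
        Nat.abs_cast]
    have hz' : |y| ≤ R := by simp [R]
    simp only [u]
    gcongr
    exact abs_besselClifford_coeff_le hκ (h m)
  rw [hs.tsum_eq_zero_add, besselClifford, ← tsum_neg]
  simp only [CharP.cast_eq_zero, zero_mul, mul_zero, zero_add, Nat.add_sub_cancel]
  refine tsum_congr fun m ↦ ?_
  have hG := (Gamma_nat_add_pos (ν := ν + 1) (by linarith) m).ne'
  have : ((m + 1 : ℕ) : ℝ) + ν + 1 = (m : ℝ) + (ν + 1) + 1 := by push_cast; ring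
  rw [this, Nat.factorial_succ]
  push_cast
  field_simp
  ring

/-- This is J_ν + J_{ν+2} = (2(ν + 1)/x) J_{ν+1} with y = (x/2)². The constant terms cancel because
Γ(ν + 2) = (ν + 1) Γ(ν + 1); the other coefficients are compared one by one. -/
lemma besselClifford_add_two {ν : ℝ} (hν : -1 < ν) (y : ℝ) :
    y * besselClifford (ν + 2) y = (ν + 1) * besselClifford (ν + 1) y - besselClifford ν y := by
  have h1 := (summable_besselClifford (ν := ν + 1) (by linarith) y).mul_left (ν + 1)
  have h0 := summable_besselClifford hν y
  simp only [besselClifford]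
  rw [← tsum_mul_left, ← tsum_mul_left, ← h1.tsum_sub h0, (h1.sub h0).tsum_eq_zero_add]
  have e : ((0 : ℕ) : ℝ) + (ν + 1) + 1 = (((0 : ℕ) : ℝ) + ν + 1) + 1 := by ring
  have hne := (Gamma_nat_add_pos hν 0).ne'
  have z : (ν + 1) * ((-1 : ℝ) ^ 0 / (((0 : ℕ).factorial : ℝ) *
      Real.Gamma (((0 : ℕ) : ℝ) + (ν + 1) + 1)) * y ^ 0) - (-1 : ℝ) ^ 0 /
      (((0 : ℕ).factorial : ℝ) * Real.Gamma (((0 : ℕ) : ℝ) + ν + 1)) * y ^ 0 = 0 := by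
    rw [e, Real.Gamma_add_one (by norm_num; linarith)]
    have : ν + 1 ≠ 0 := by linarith
    simp at hne ⊢
    field_simp
    ring
  rw [z, zero_add]
  refine tsum_congr fun m ↦ ?_
  have hm : (0 : ℝ) ≤ m := m.cast_nonneg
  have hG := (Gamma_nat_add_pos (ν := ν + 1) (by linarith) m).ne'
  have e1 : ((m + 1 : ℕ) : ℝ) + ν + 1 = (m : ℝ) + (ν + 1) + 1 := by push_cast; ring
  have e2 : ((m + 1 : ℕ) : ℝ) + (ν + 1) + 1 = ((m : ℝ) + (ν + 1) + 1) + 1 := by push_cast; ring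
  have e3 : (m : ℝ) + (ν + 2) + 1 = ((m : ℝ) + (ν + 1) + 1) + 1 := by ring
  have hne : (m : ℝ) + (ν + 1) + 1 ≠ 0 := by linarith
  rw [e1, e2, e3, Real.Gamma_add_one hne, Nat.factorial_succ]
  push_cast
  field_simp
  ring

lemma hasDerivAt_besselEntire {ν : ℝ} (hν : -1 < ν) (x : ℝ) :
    HasDerivAt (besselEntire ν) (-(x / 2) * besselEntire (ν + 1) x) x := by
  have h1 : HasDerivAt (fun x : ℝ ↦ (x / 2) ^ 2) (x / 2) x := by
    refine (((hasDerivAt_id x).div_const 2).pow 2).congr_deriv ?_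
    simp
    ring
  refine ((hasDerivAt_besselClifford hν ((x / 2) ^ 2)).comp x h1).congr_deriv ?_
  rw [besselEntire]
  ring

lemma sq_mul_besselEntire_add_two {ν : ℝ} (hν : -1 < ν) (x : ℝ) :
    x ^ 2 * besselEntire (ν + 2) x
      = 4 * ((ν + 1) * besselEntire (ν + 1) x - besselEntire ν x) := by
  have := besselClifford_add_two hν ((x / 2) ^ 2)
  simp only [besselEntire]
  linear_combination 4 * this

lemma besselEntire_neg (ν x : ℝ) : besselEntire ν (-x) = besselEntire ν x := by
  simp [besselEntire, neg_div]

lemma besselEntire_zero_pos {ν : ℝ} (hν : -1 < ν) : 0 < besselEntire ν 0 := by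
  have : besselEntire ν 0 = 1 / Real.Gamma (ν + 1) := by
    simp only [besselEntire, besselClifford]
    rw [tsum_eq_single 0 (by intro m hm; simp [hm])]
    simp
  rw [this]
  exact one_div_pos.mpr (Real.Gamma_pos_of_pos (by linarith))

lemma continuous_besselEntire {ν : ℝ} (hν : -1 < ν) : Continuous (besselEntire ν) :=
  continuous_iff_continuousAt.mpr fun x ↦ (hasDerivAt_besselEntire hν x).continuousAt

lemma besselJ_eq {ν x : ℝ} (hx : 0 < x) :
    besselJ ν x = (x / 2) ^ ν * besselEntire ν x := by
  simp only [besselJ, besselEntire, besselClifford]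
  rw [← tsum_mul_left]
  refine tsum_congr fun m ↦ ?_
  rw [Real.rpow_add (by positivity), ← pow_mul]
  have : (x / 2) ^ (2 * (m : ℝ)) = (x / 2) ^ (2 * m) := by
    rw [← Real.rpow_natCast]; norm_cast
  rw [this]
  ring

/-- The derivative of `besselEntire ν`. -/
noncomputable def besselEntire' (ν x : ℝ) : ℝ := -(x / 2) * besselEntire (ν + 1) x

/-- Bessel's equation for g, x g'' + (2ν + 1) g' + x g = 0, in a first-order form that is also valid
at 0. -/
lemma hasDerivAt_mul_besselEntire' {ν : ℝ} (hν : -1 < ν) (x : ℝ) :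
    HasDerivAt (fun x ↦ x * besselEntire' ν x)
      (-2 * ν * besselEntire' ν x - x * besselEntire ν x) x := by
  have h := (hasDerivAt_besselEntire (ν := ν + 1) (by linarith) x)
  have h2 := (((hasDerivAt_id x).pow 2).div_const (-2)).mul h
  have e : (fun x ↦ x * besselEntire' ν x)
      = fun x ↦ (id x ^ 2 / (-2)) * besselEntire (ν + 1) x := by
    ext y; simp only [besselEntire', id]; ring
  rw [e]
  refine h2.congr_deriv ?_
  have := sq_mul_besselEntire_add_two hν x
  have e2 : ν + 1 + 1 = ν + 2 := by ring
  simp only [besselEntire', id, e2, Pi.pow_apply]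
  push_cast
  linear_combination (x / 4) * this

/-- `deriv j_{ν,δ}` vanishes exactly where `x g' + (ν - δ) g` does, for `g = (x/2)^(-ν) J_ν`. -/
lemma derivZeros_eq {ν : ℝ} (hν : -1 < ν) (δ : ℝ) :
    derivZeros ν δ = {x | 0 < x ∧ x * besselEntire' ν x + (ν - δ) * besselEntire ν x = 0} := by
  ext x
  simp only [derivZeros, mem_ofPred_eq]
  refine and_congr_right fun hx ↦ ?_
  have e : ultraJ ν δ =ᶠ[𝓝 x] fun y ↦ 2 ^ (-ν) * (y ^ (ν - δ) * besselEntire ν y) := by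
    filter_upwards [lt_mem_nhds hx] with y hy
    rw [ultraJ, besselJ_eq hy, Real.div_rpow hy.le (by norm_num), sub_eq_add_neg,
      Real.rpow_add hy, Real.rpow_neg (x := 2) (by norm_num)]
    ring
  have hd := ((Real.hasDerivAt_rpow_const (p := ν - δ) (Or.inl hx.ne')).mul
    (hasDerivAt_besselEntire hν x)).const_mul ((2 : ℝ) ^ (-ν))
  rw [e.deriv_eq]
  erw [hd.deriv]
  have h2 : (2 : ℝ) ^ (-ν) * ((ν - δ) * x ^ (ν - δ - 1) * besselEntire ν x
      + x ^ (ν - δ) * (-(x / 2) * besselEntire (ν + 1) x))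
      = (2 : ℝ) ^ (-ν) * x ^ (ν - δ - 1)
        * (x * besselEntire' ν x + (ν - δ) * besselEntire ν x) := by
    have : x ^ (ν - δ) = x ^ (ν - δ - 1) * x := by
      rw [← Real.rpow_add_one hx.ne']; ring_nf
    rw [this, besselEntire']
    ring
  rw [h2, mul_eq_zero, or_iff_right (by positivity)]

/-! ### Angles of plane curves, limits at infinity, enumeration -/

/-- A planar `C¹` curve `(p, q)` avoiding the origin has a differentiable angle function. -/
lemma exists_angle {p q p' q' : ℝ → ℝ} (hp : ∀ x, HasDerivAt p (p' x) x)
    (hq : ∀ x, HasDerivAt q (q' x) x) (hp' : Continuous p') (hq' : Continuous q')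
    (hpos : ∀ x, 0 < p x ^ 2 + q x ^ 2) (hp0 : p 0 = 0) (hq0 : 0 < q 0) :
    ∃ θ : ℝ → ℝ, θ 0 = 0 ∧
      (∀ x, HasDerivAt θ ((p' x * q x - p x * q' x) / (p x ^ 2 + q x ^ 2)) x) ∧
      ∀ x, p x = √(p x ^ 2 + q x ^ 2) * Real.sin (θ x) ∧
        q x = √(p x ^ 2 + q x ^ 2) * Real.cos (θ x) := by
  have hpc : Continuous p := continuous_iff_continuousAt.mpr fun x ↦ (hp x).continuousAt
  have hqc : Continuous q := continuous_iff_continuousAt.mpr fun x ↦ (hq x).continuousAt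
  set f : ℝ → ℝ := fun x ↦ (p' x * q x - p x * q' x) / (p x ^ 2 + q x ^ 2)
  have hf : Continuous f := by
    refine Continuous.div (by fun_prop) (by fun_prop) fun x ↦ (hpos x).ne'
  set θ : ℝ → ℝ := fun x ↦ ∫ t in (0 : ℝ)..x, f t
  have hθ : ∀ x, HasDerivAt θ (f x) x := fun x ↦ hf.integral_hasStrictDerivAt 0 x |>.hasDerivAt
  have hθ0 : θ 0 = 0 := by simp [θ]
  have hθc : Continuous θ := continuous_iff_continuousAt.mpr fun x ↦ (hθ x).continuousAt
  refine ⟨θ, hθ0, hθ, ?_⟩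
  -- `A` and `B` are the coordinates of (p, q) in the frame rotated by θ. The ratio A²/(p² + q²) is
  -- constant and starts at 0, so A vanishes; then B² = p² + q² never vanishes and B keeps its
  -- initial sign.
  set A : ℝ → ℝ := fun x ↦ p x * Real.cos (θ x) - q x * Real.sin (θ x)
  set B : ℝ → ℝ := fun x ↦ p x * Real.sin (θ x) + q x * Real.cos (θ x)
  have hA : ∀ x, HasDerivAt (fun x ↦ A x ^ 2 / (p x ^ 2 + q x ^ 2)) 0 x := by
    intro x
    have hs := (hθ x).sin
    have hc := (hθ x).cos
    have h1 := (((hp x).mul hc).sub ((hq x).mul hs)).pow 2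
    have h2 := ((hp x).pow 2).add ((hq x).pow 2)
    refine (h1.div h2 (hpos x).ne').congr_deriv ?_
    have hne := (hpos x).ne'
    simp only [f, Pi.mul_apply, Pi.pow_apply, Pi.sub_apply, Pi.add_apply]
    field_simp
    push_cast
    ring
  have hA0 : ∀ x, A x = 0 := by
    intro x
    have := is_const_of_deriv_eq_zero (fun x ↦ (hA x).differentiableAt)
      (fun x ↦ (hA x).deriv) x 0
    have h0 : A 0 = 0 := by simp [A, hθ0, hp0]
    rw [h0] at this
    simpa [(hpos x).ne'] using this
  have hAB : ∀ x, B x ^ 2 = p x ^ 2 + q x ^ 2 := by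
    intro x
    have h1 := hA0 x
    have h2 := Real.sin_sq_add_cos_sq (θ x)
    simp only [A, B] at h1 ⊢
    linear_combination (p x ^ 2 + q x ^ 2) * h2
      - (p x * Real.cos (θ x) - q x * Real.sin (θ x)) * h1
  have hBc : Continuous B := by fun_prop
  have hB : ∀ x, 0 < B x := by
    intro x
    by_contra hx
    have h0 : 0 < B 0 := by simp [B, hθ0, hq0]
    obtain ⟨z, hz⟩ := mem_range_of_exists_le_of_exists_ge hBc ⟨x, not_lt.mp hx⟩ ⟨0, h0.le⟩
    have := hAB z
    rw [hz] at this
    have := hpos z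
    simp_all
  intro x
  have hsq : √(p x ^ 2 + q x ^ 2) = B x := by
    rw [← hAB x, Real.sqrt_sq (hB x).le]
  rw [hsq]
  have h1 := hA0 x
  have h2 := Real.sin_sq_add_cos_sq (θ x)
  simp only [A, B] at h1 ⊢
  constructor
  · linear_combination -p x * h2 + Real.cos (θ x) * h1
  · linear_combination -q x * h2 - Real.sin (θ x) * h1

/-- Two angles that start in a common open half-plane and whose directions are never opposite
differ by less than `π`. -/
lemma abs_sub_lt_pi_of_forall_cos_ne {θ χ : ℝ → ℝ} (hθ : Continuous θ) (hχ : Continuous χ)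
    (h0 : |θ 0 - χ 0| < Real.pi)
    (h : ∀ x, 0 < x → ¬ (Real.sin (θ x) = -Real.sin (χ x) ∧ Real.cos (θ x) = -Real.cos (χ x)))
    {x : ℝ} (hx : 0 ≤ x) : |θ x - χ x| < Real.pi := by
  by_contra hcon
  have hc : ContinuousOn (fun y ↦ |θ y - χ y|) (Icc 0 x) := by fun_prop
  obtain ⟨z, hz, hzπ⟩ := intermediate_value_Icc hx hc ⟨h0.le, not_lt.mp hcon⟩
  have hz0 : 0 < z := by
    rcases hz.1.eq_or_lt with rfl | h'
    · exact absurd hzπ h0.ne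
    · exact h'
  apply h z hz0
  rcases (abs_eq Real.pi_pos.le).mp hzπ with e | e
  · have : θ z = χ z + Real.pi := by linarith
    rw [this, Real.sin_add_pi, Real.cos_add_pi]; simp
  · have : θ z = χ z - Real.pi := by linarith
    rw [this, Real.sin_sub_pi, Real.cos_sub_pi]; simp

/-- After subtraction of kπ, the angle a lies in (-π, 2π) with positive sine, which leaves only (0,
π). -/
lemma int_mul_pi_lt_of_sin_pos_iff {a b : ℝ} {k : ℤ} (hab : |a - b| < Real.pi)
    (hs : 0 < Real.sin a * Real.sin b)
    (hb : b ∈ Ioo (k * Real.pi) ((k + 1) * Real.pi)) :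
    a ∈ Ioo (k * Real.pi) ((k + 1) * Real.pi) := by
  have hπ := Real.pi_pos
  obtain ⟨h1, h2⟩ := abs_lt.mp hab
  set a' := a - k * Real.pi with ha'
  set b' := b - k * Real.pi with hb'
  have hb1 : 0 < b' := by simp only [hb']; linarith [hb.1]
  have hb2 : b' < Real.pi := by simp only [hb']; linarith [hb.2]
  have hs' : 0 < Real.sin a' * Real.sin b' := by
    have h3 : ((-1 : ℝ) ^ k) * ((-1 : ℝ) ^ k) = 1 := by
      rw [← mul_zpow]; simp
    rw [ha', hb', Real.sin_sub_int_mul_pi, Real.sin_sub_int_mul_pi]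
    calc _ < _ := hs
      _ = _ := by linear_combination (-Real.sin a * Real.sin b) * h3
  have hsb : 0 < Real.sin b' := Real.sin_pos_of_pos_of_lt_pi hb1 hb2
  have hsa : 0 < Real.sin a' := (pos_iff_pos_of_mul_pos hs').mpr hsb
  have ha1 : -Real.pi < a' := by simp only [ha']; linarith
  have ha2 : a' < 2 * Real.pi := by simp only [ha']; linarith
  constructor
  · by_contra hcon
    have : Real.sin a' ≤ 0 := Real.sin_nonpos_of_nonpos_of_neg_pi_le (by linarith) ha1.le
    linarith
  · by_contra hcon
    have : 0 ≤ Real.sin (a' - Real.pi) :=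
      Real.sin_nonneg_of_nonneg_of_le_pi (by linarith) (by linarith)
    rw [Real.sin_sub_pi] at this
    linarith

/-- A function with derivative `O(1/x²)` converges at infinity at the rate `O(1/x)`. -/
lemma exists_limit_of_deriv_bound {f f' : ℝ → ℝ} {M : ℝ}
    (hf : ∀ x, 1 ≤ x → HasDerivAt f (f' x) x) (hb : ∀ x, 1 ≤ x → |f' x| ≤ M / x ^ 2) :
    ∃ l : ℝ, ∀ x, 1 ≤ x → |f x - l| ≤ M / x := by
  have hd : ∀ x : ℝ, 1 ≤ x → HasDerivAt (fun x ↦ M / x) (-(M / x ^ 2)) x := by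
    intro x hx
    have : x ≠ 0 := by positivity
    refine ((hasDerivAt_inv this).const_mul M).congr_deriv ?_
    ring
  -- f - M/x increases, f + M/x decreases, and every value of the first is at most every value of
  -- the second. The supremum of the first therefore serves as the limit.
  have hmono : MonotoneOn (fun x ↦ f x - M / x) (Ici 1) := by
    refine monotoneOn_of_hasDerivWithinAt_nonneg (f' := fun x ↦ f' x - -(M / x ^ 2)) (convex_Ici 1)
      (fun x hx ↦ ((hf x hx).sub (hd x hx)).continuousAt.continuousWithinAt)
      (fun x hx ↦ ((hf x ?_).sub (hd x ?_)).hasDerivWithinAt) fun x hx ↦ ?_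
    · exact interior_subset hx
    · exact interior_subset hx
    · have := neg_le_of_abs_le (hb x (interior_subset hx)); linarith
  have hanti : AntitoneOn (fun x ↦ f x + M / x) (Ici 1) := by
    refine antitoneOn_of_hasDerivWithinAt_nonpos (f' := fun x ↦ f' x + -(M / x ^ 2)) (convex_Ici 1)
      (fun x hx ↦ ((hf x hx).add (hd x hx)).continuousAt.continuousWithinAt)
      (fun x hx ↦ ((hf x ?_).add (hd x ?_)).hasDerivWithinAt) fun x hx ↦ ?_
    · exact interior_subset hx
    · exact interior_subset hx
    · have := le_of_abs_le (hb x (interior_subset hx)); linarith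
  have hM : 0 ≤ M := by
    have := (abs_nonneg _).trans (hb 1 le_rfl)
    simpa using this
  have hle : ∀ x y, 1 ≤ x → 1 ≤ y → f x - M / x ≤ f y + M / y := by
    intro x y hx hy
    have h1 : 0 ≤ M / x := by positivity
    have h2 : 0 ≤ M / y := by positivity
    rcases le_total x y with h | h
    · have := hmono hx hy h; simp only at this; linarith
    · have := hanti hy hx h; simp only at this; linarith
  refine ⟨sSup ((fun x ↦ f x - M / x) '' Ici 1), fun x hx ↦ ?_⟩
  have h1 : f x - M / x ≤ sSup ((fun x ↦ f x - M / x) '' Ici 1) :=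
    le_csSup ⟨f 1 + M / 1, by rintro _ ⟨y, hy, rfl⟩; exact hle y 1 hy le_rfl⟩ ⟨x, hx, rfl⟩
  have h2 : sSup ((fun x ↦ f x - M / x) '' Ici 1) ≤ f x + M / x :=
    csSup_le ⟨_, 1, mem_Ici.mpr le_rfl, rfl⟩ (by rintro _ ⟨y, hy, rfl⟩; exact hle y x hy hx)
  rw [abs_le]
  constructor <;> linarith

lemma increasingList_range {b : ℕ → ℝ} (hb : StrictMono b) (n : ℕ) :
    increasingList (range b) n = b n := by
  induction n with
  | zero =>
    refine IsLeast.csInf_eq ⟨⟨0, rfl⟩, ?_⟩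
    rintro _ ⟨m, rfl⟩
    exact hb.monotone m.zero_le
  | succ n ih =>
    rw [increasingList, ih]
    refine IsLeast.csInf_eq ⟨⟨⟨n + 1, rfl⟩, hb n.lt_succ_self⟩, ?_⟩
    rintro _ ⟨⟨m, rfl⟩, hm⟩
    exact hb.monotone (hb.lt_iff_lt.mp hm)

/-! ### Lommel's inequality and the two phases -/

lemma hasDerivAt_besselEntire_eq {ν : ℝ} (hν : -1 < ν) (x : ℝ) :
    HasDerivAt (besselEntire ν) (besselEntire' ν x) x := hasDerivAt_besselEntire hν x

lemma continuous_besselEntire' {ν : ℝ} (hν : -1 < ν) : Continuous (besselEntire' ν) := by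
  have := continuous_besselEntire (ν := ν + 1) (by linarith)
  unfold besselEntire'
  fun_prop

lemma besselEntire'_neg (ν x : ℝ) : besselEntire' ν (-x) = -besselEntire' ν x := by
  simp only [besselEntire', besselEntire_neg]; ring

/-- Lommel's inequality: `x² J'² + (x² - ν²) J² > 0`, written for `g = (x/2)^(-ν) J_ν`. -/
lemma lommel_pos {ν x : ℝ} (hν : -1 < ν) (hx : 0 < x) :
    0 < (x * besselEntire' ν x) ^ 2 + 2 * ν * besselEntire ν x * (x * besselEntire' ν x)
      + x ^ 2 * besselEntire ν x ^ 2 := by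
  set g := besselEntire ν
  set w : ℝ → ℝ := fun x ↦ x * besselEntire' ν x
  set Λ : ℝ → ℝ := fun x ↦ w x ^ 2 + 2 * ν * g x * w x + x ^ 2 * g x ^ 2 with hΛ
  -- Up to the factor 4^ν this is x² J'² + (x² - ν²) J², whose derivative is 2x J².
  set W : ℝ → ℝ := fun x ↦ x ^ (2 * ν) * Λ x
  have hg := fun x ↦ hasDerivAt_besselEntire_eq hν x
  have hgc := continuous_besselEntire hν
  have hg1c := continuous_besselEntire (ν := ν + 1) (by linarith)
  have hW : ∀ y, 0 < y → HasDerivAt W (2 * y ^ (2 * ν + 1) * g y ^ 2) y := by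
    intro y hy
    have hw := hasDerivAt_mul_besselEntire' hν y
    have h1 := ((hw.pow 2).add (((hg y).const_mul (2 * ν)).mul hw)).add
      (((hasDerivAt_id y).pow 2).mul ((hg y).pow 2))
    have h2 := (Real.hasDerivAt_rpow_const (p := 2 * ν) (Or.inl hy.ne')).mul h1
    refine h2.congr_deriv ?_
    have e1 : y ^ (2 * ν + 1) = y ^ (2 * ν - 1) * y ^ 2 := by
      rw [← Real.rpow_natCast, ← Real.rpow_add hy]; congr 1; push_cast; ring
    have e2 : y ^ (2 * ν) = y ^ (2 * ν - 1) * y := by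
      rw [← Real.rpow_add_one hy.ne']; ring_nf
    rw [e1, e2]
    simp only [Pi.mul_apply, Pi.pow_apply, Pi.add_apply, id, g]
    push_cast
    ring
  -- The same function with x² taken out of `Λ` through g' = -(x/2) g_{ν+1}. As 2ν + 2 > 0, this
  -- form is continuous at 0 even for negative ν.
  set V : ℝ → ℝ := fun x ↦ x ^ (2 * ν + 2) * (x ^ 2 / 4 * besselEntire (ν + 1) x ^ 2 + g x ^ 2
    - ν * g x * besselEntire (ν + 1) x)
  have hVW : ∀ y, 0 < y → V y = W y := by
    intro y hy
    have : y ^ (2 * ν + 2) = y ^ (2 * ν) * y ^ 2 := by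
      rw [← Real.rpow_natCast, ← Real.rpow_add hy]; norm_num
    simp only [V, W, Λ, w, g, besselEntire', this]
    ring
  have hVc : Continuous V := by
    have : Continuous fun x : ℝ ↦ x ^ (2 * ν + 2) :=
      Real.continuous_rpow_const (by linarith)
    fun_prop
  have hV0 : V 0 = 0 := by simp [V, Real.zero_rpow (show 2 * ν + 2 ≠ 0 by linarith)]
  have hVd : ∀ y, 0 < y → HasDerivAt V (2 * y ^ (2 * ν + 1) * g y ^ 2) y := fun y hy ↦
    (hW y hy).congr_of_eventuallyEq (by filter_upwards [lt_mem_nhds hy] with z hz using hVW z hz)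
  have hmono : MonotoneOn V (Ici 0) := by
    refine monotoneOn_of_hasDerivWithinAt_nonneg (f' := fun y ↦ 2 * y ^ (2 * ν + 1) * g y ^ 2)
      (convex_Ici 0) hVc.continuousOn (fun y hy ↦ ?_) fun y hy ↦ ?_
    · rw [interior_Ici] at hy ⊢
      exact (hVd y hy).hasDerivWithinAt
    · rw [interior_Ici] at hy
      have : 0 < y := hy
      positivity
  have hVx : 0 < V x := by
    by_contra hcon
    -- If V(x) ≤ 0, monotonicity from V(0) = 0 makes V vanish on (0, x). So does its derivative,
    -- hence g, and by continuity g(0) = 0, which is false.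
    have hz : ∀ y ∈ Ioo 0 x, g y = 0 := by
      intro y hy
      have hV : V =ᶠ[𝓝 y] fun _ ↦ 0 := by
        filter_upwards [Ioo_mem_nhds hy.1 hy.2] with z hz
        have h1 := hmono (mem_Ici.mpr le_rfl) (mem_Ici.mpr hz.1.le) hz.1.le
        have h2 := hmono (mem_Ici.mpr hz.1.le) (mem_Ici.mpr hx.le) hz.2.le
        linarith
      have h0 := (hVd y hy.1).unique ((hasDerivAt_const y (0 : ℝ)).congr_of_eventuallyEq hV)
      have hy0 := hy.1
      have : 2 * y ^ (2 * ν + 1) ≠ 0 := by positivity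
      simpa [this] using h0
    have h0 : g 0 = 0 := by
      have hcl : (0 : ℝ) ∈ closure (Ioo 0 x) := by
        rw [closure_Ioo hx.ne]; exact left_mem_Icc.mpr hx.le
      exact closure_minimal (fun y hy ↦ hz y hy) (isClosed_singleton.preimage hgc) hcl
    exact (besselEntire_zero_pos hν).ne' h0
  rw [hVW x hx] at hVx
  exact (pos_iff_pos_of_mul_pos hVx).mp (by positivity)

/-- `ψ` is the continuous angle of `(-x g', g)`, where `g = (x/2)^(-ν) J_ν`. -/
structure IsDerivPhase (ν : ℝ) (ψ : ℝ → ℝ) : Prop where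
  zero : ψ 0 = 0
  continuous : Continuous ψ
  strictMonoOn : StrictMonoOn ψ (Ici 0)
  polar : ∀ x, ∃ R, 0 < R ∧ -(x * besselEntire' ν x) = R * Real.sin (ψ x) ∧
    besselEntire ν x = R * Real.cos (ψ x)

/-- The squared norm of `(x g, x g' + (ν + 1/2) g)`, that is, up to a power of `x`, of `(u, u')`
for `u = √x J_ν`. -/
noncomputable def besselNormSq (ν x : ℝ) : ℝ :=
  (x * besselEntire ν x) ^ 2 + (x * besselEntire' ν x + (ν + 1 / 2) * besselEntire ν x) ^ 2

/-- `θ` is the Prüfer angle of `u = √x J_ν`, that is, the continuous angle of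
`(x g, x g' + (ν + 1/2) g)`. -/
structure IsPruferPhase (ν : ℝ) (θ : ℝ → ℝ) : Prop where
  zero : θ 0 = 0
  deriv : ∀ x, HasDerivAt θ
    (1 - (ν ^ 2 - 1 / 4) * (besselEntire ν x ^ 2 / besselNormSq ν x)) x
  sin : ∀ x, x * besselEntire ν x = √(besselNormSq ν x) * Real.sin (θ x)
  cos : ∀ x, x * besselEntire' ν x + (ν + 1 / 2) * besselEntire ν x
    = √(besselNormSq ν x) * Real.cos (θ x)

lemma besselEntire_ne_zero_or {ν : ℝ} (hν : -1 < ν) (x : ℝ) (h : besselEntire ν x = 0) :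
    x * besselEntire' ν x ≠ 0 := by
  rcases lt_trichotomy x 0 with hx | rfl | hx
  · have := lommel_pos hν (neg_pos.mpr hx)
    rw [besselEntire_neg, besselEntire'_neg, h] at this
    intro h'
    simp [h'] at this
  · exact absurd h (besselEntire_zero_pos hν).ne'
  · have := lommel_pos hν hx
    intro h'
    simp [h', h] at this

lemma besselNormSq_pos {ν : ℝ} (hν : -(1 / 2) < ν) (x : ℝ) : 0 < besselNormSq ν x := by
  have hν1 : -1 < ν := by linarith
  unfold besselNormSq
  by_cases h : besselEntire ν x = 0
  · have := besselEntire_ne_zero_or hν1 x h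
    have h2 := sq_pos_iff.mpr this
    rw [h]
    linarith
  · by_cases hx : x = 0
    · have : ν + 1 / 2 ≠ 0 := by linarith
      rw [hx] at h ⊢
      rw [zero_mul, zero_mul, zero_add]
      positivity
    · positivity

/-- The numerator of ψ', multiplied by x, is Lommel's form; this makes ψ strictly increasing. -/
lemma exists_isDerivPhase {ν : ℝ} (hν : -1 < ν) : ∃ ψ, IsDerivPhase ν ψ := by
  have hg := fun x ↦ hasDerivAt_besselEntire_eq hν x
  have hgc := continuous_besselEntire hν
  have hg'c := continuous_besselEntire' hν
  have hpos : ∀ x, 0 < (-(x * besselEntire' ν x)) ^ 2 + besselEntire ν x ^ 2 := by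
    intro x
    by_cases h : besselEntire ν x = 0
    · have := neg_ne_zero.mpr (besselEntire_ne_zero_or hν x h)
      positivity
    · positivity
  obtain ⟨ψ, h0, hd, hpol⟩ := exists_angle (p := fun x ↦ -(x * besselEntire' ν x))
    (fun x ↦ (hasDerivAt_mul_besselEntire' hν x).neg) hg (by fun_prop) hg'c hpos (by simp)
    (besselEntire_zero_pos hν)
  have hc : Continuous ψ := continuous_iff_continuousAt.mpr fun x ↦ (hd x).continuousAt
  refine ⟨ψ, h0, hc, ?_, fun x ↦ ⟨_, Real.sqrt_pos.mpr (hpos x), hpol x⟩⟩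
  refine strictMonoOn_of_hasDerivWithinAt_pos (convex_Ici 0) hc.continuousOn
    (fun x _ ↦ (hd x).hasDerivWithinAt) fun x hx ↦ ?_
  rw [interior_Ici] at hx
  have hx : 0 < x := hx
  refine div_pos ?_ (hpos x)
  have h1 := lommel_pos hν hx
  refine pos_of_mul_pos_right (a := x) ?_ hx.le
  refine h1.trans_eq ?_
  ring

/-- The equation of u gives θ' = 1 - (ν² - 1/4) sin²θ/x². Since sin²θ = x² g²/N with N the squared
norm, the quotient is g²/N, which is regular at 0. -/
lemma exists_isPruferPhase {ν : ℝ} (hν : -(1 / 2) < ν) : ∃ θ, IsPruferPhase ν θ := by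
  have hν1 : -1 < ν := by linarith
  have hg := fun x ↦ hasDerivAt_besselEntire_eq hν1 x
  have hgc := continuous_besselEntire hν1
  have hg'c := continuous_besselEntire' hν1
  have hp : ∀ x, HasDerivAt (fun x ↦ x * besselEntire ν x)
      (besselEntire ν x + x * besselEntire' ν x) x := fun x ↦
    ((hasDerivAt_id x).mul (hg x)).congr_deriv (by simp)
  have hq : ∀ x, HasDerivAt (fun x ↦ x * besselEntire' ν x + (ν + 1 / 2) * besselEntire ν x)
      (-2 * ν * besselEntire' ν x - x * besselEntire ν x + (ν + 1 / 2) * besselEntire' ν x) x :=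
    fun x ↦ (hasDerivAt_mul_besselEntire' hν1 x).add ((hg x).const_mul _)
  have h00 := besselEntire_zero_pos hν1
  obtain ⟨θ, h0, hd, hpol⟩ := exists_angle hp hq (by fun_prop) (by fun_prop)
    (besselNormSq_pos hν) (by simp) (by
      have : 0 < ν + 1 / 2 := by linarith
      simpa using mul_pos this h00)
  refine ⟨θ, h0, fun x ↦ (hd x).congr_deriv ?_, fun x ↦ (hpol x).1, fun x ↦ (hpol x).2⟩
  have := (besselNormSq_pos hν x).ne'
  rw [eq_comm, eq_div_iff (by exact this)]
  change _ * besselNormSq ν x = _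
  field_simp
  rw [besselNormSq]
  ring

/-! ### Comparison of the phases and their behaviour at infinity -/

lemma IsPruferPhase.continuous {ν : ℝ} {θ : ℝ → ℝ} (h : IsPruferPhase ν θ) : Continuous θ :=
  continuous_iff_continuousAt.mpr fun x ↦ (h.deriv x).continuousAt

/-- The directions are those of (x g, x g' + (ν + 1/2) g) and (g, x g'). For x > 0 the first
coordinates have the same sign, and where they vanish the second coordinates agree, so the
directions are never opposite. -/
lemma IsPruferPhase.abs_sub_derivPhase_lt {ν : ℝ} {θ ψ : ℝ → ℝ} (hν : -(1 / 2) < ν)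
    (hθ : IsPruferPhase ν θ) (hψ : IsDerivPhase ν ψ) {x : ℝ} (hx : 0 ≤ x) :
    |θ x - (ψ x + Real.pi / 2)| < Real.pi := by
  have hψc := hψ.continuous
  refine abs_sub_lt_pi_of_forall_cos_ne (χ := fun x ↦ ψ x + Real.pi / 2) hθ.continuous
    (by fun_prop) ?_ (fun y hy ↦ ?_) hx
  · rw [hθ.zero, hψ.zero, abs_lt]
    constructor <;> linarith [Real.pi_pos]
  · rintro ⟨hs, hc⟩
    rw [Real.sin_add_pi_div_two] at hs
    rw [Real.cos_add_pi_div_two, neg_neg] at hc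
    obtain ⟨R, hR, e1, e2⟩ := hψ.polar y
    have hρ := Real.sqrt_pos.mpr (besselNormSq_pos hν y)
    have e3 := hθ.sin y
    have e4 := hθ.cos y
    set ρ := √(besselNormSq ν y)
    have h1 : Real.cos (ψ y) = 0 := by
      have : (ρ + y * R) * Real.cos (ψ y) = 0 := by
        rw [hs] at e3; linear_combination -y * e2 + e3
      exact (mul_eq_zero.mp this).resolve_left (by positivity)
    have h2 : Real.sin (ψ y) = 0 := by
      have : (ρ + R) * Real.sin (ψ y) = 0 := by
        rw [hc] at e4; rw [h1] at e2; linear_combination -e1 - e4 + (ν + 1 / 2) * e2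
      exact (mul_eq_zero.mp this).resolve_left (by positivity)
    have := Real.sin_sq_add_cos_sq (ψ y)
    rw [h1, h2] at this
    norm_num at this

/-- Here ψ is the angle of (x² g_{ν+1}/2, g_ν), whose first coordinate has the sign of x g_{ν+1}.
Where g_{ν+1} = 0, the recurrence turns the second coordinate x g_{ν+1}' of the Prüfer vector into 2
g_ν, so again the directions are never opposite. -/
lemma IsPruferPhase.abs_sub_derivPhase_sub_one_lt {ν : ℝ} {θ ψ : ℝ → ℝ} (hν : -(1 / 2) < ν)
    (hθ : IsPruferPhase (ν + 1) θ) (hψ : IsDerivPhase ν ψ) {x : ℝ} (hx : 0 ≤ x) :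
    |θ x - ψ x| < Real.pi := by
  have hψc := hψ.continuous
  refine abs_sub_lt_pi_of_forall_cos_ne hθ.continuous hψc ?_ (fun y hy ↦ ?_) hx
  · rw [hθ.zero, hψ.zero]
    simpa using Real.pi_pos
  · rintro ⟨hs, hc⟩
    obtain ⟨R, hR, e1, e2⟩ := hψ.polar y
    have hρ := Real.sqrt_pos.mpr (besselNormSq_pos (ν := ν + 1) (by linarith) y)
    have e3 := hθ.sin y
    have e4 := hθ.cos y
    have e5 := sq_mul_besselEntire_add_two (ν := ν) (by linarith) y
    set ρ := √(besselNormSq (ν + 1) y)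
    have e6 : ν + 1 + 1 = ν + 2 := by ring
    simp only [besselEntire', e6] at e1 e4
    have h1 : Real.sin (ψ y) = 0 := by
      have : (y / 2 * ρ + R) * Real.sin (ψ y) = 0 := by
        rw [hs] at e3; linear_combination -e1 + y / 2 * e3
      exact (mul_eq_zero.mp this).resolve_left (by positivity)
    have h3 : besselEntire (ν + 1) y = 0 := by
      rw [hs, h1, neg_zero, mul_zero] at e3
      exact (mul_eq_zero.mp e3).resolve_left hy.ne'
    have h2 : Real.cos (ψ y) = 0 := by
      have : (ρ + 2 * R) * Real.cos (ψ y) = 0 := by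
        rw [hc] at e4
        linear_combination e4 - 2 * e2 + e5 / 2 - (ν + 1 + 1 / 2) * h3 + 2 * (ν + 1) * h3
      exact (mul_eq_zero.mp this).resolve_left (by positivity)
    have := Real.sin_sq_add_cos_sq (ψ y)
    rw [h1, h2] at this
    norm_num at this

lemma besselEntire_sq_div_normSq_le {ν x : ℝ} (hν : -(1 / 2) < ν) (hx : 0 < x) :
    besselEntire ν x ^ 2 / besselNormSq ν x ≤ 1 / x ^ 2 := by
  rw [div_le_div_iff₀ (besselNormSq_pos hν x) (by positivity), besselNormSq]
  nlinarith [sq_nonneg (x * besselEntire' ν x + (ν + 1 / 2) * besselEntire ν x)]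

lemma IsPruferPhase.exists_limit {ν : ℝ} {θ : ℝ → ℝ} (hν : -(1 / 2) < ν)
    (hθ : IsPruferPhase ν θ) :
    ∃ c : ℝ, ∀ x, 1 ≤ x → |θ x - x - c| ≤ |ν ^ 2 - 1 / 4| / x := by
  refine exists_limit_of_deriv_bound (fun x _ ↦ (hθ.deriv x).sub (hasDerivAt_id x)) fun x hx ↦ ?_
  have h1 := besselEntire_sq_div_normSq_le hν (by linarith : 0 < x)
  have h2 : 0 ≤ besselEntire ν x ^ 2 / besselNormSq ν x :=
    div_nonneg (sq_nonneg _) (besselNormSq_pos hν x).le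
  rw [sub_right_comm, sub_self, zero_sub, abs_neg, abs_mul, abs_of_nonneg h2]
  calc _ ≤ |ν ^ 2 - 1 / 4| * (1 / x ^ 2) := by gcongr
    _ = _ := by ring

/-- For |ν| ≤ 1/2 the potential term has a sign: θ' ≥ 1. With `IsPruferPhase.le_self`, where θ' ≤ 1,
this later fixes the multiple of π in the phase. -/
lemma IsPruferPhase.self_le {ν : ℝ} {θ : ℝ → ℝ} (hν : -(1 / 2) < ν) (hν2 : ν ≤ 1 / 2)
    (hθ : IsPruferPhase ν θ) {x : ℝ} (hx : 0 ≤ x) : x ≤ θ x := by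
  have : Monotone fun x ↦ θ x - x := by
    refine monotone_of_hasDerivAt_nonneg (fun x ↦ (hθ.deriv x).sub (hasDerivAt_id x)) fun x ↦ ?_
    have h2 : 0 ≤ besselEntire ν x ^ 2 / besselNormSq ν x :=
      div_nonneg (sq_nonneg _) (besselNormSq_pos hν x).le
    have h3 : ν ^ 2 - 1 / 4 ≤ 0 := by nlinarith
    have := mul_nonpos_of_nonpos_of_nonneg h3 h2
    simp only [Pi.zero_apply]
    linarith
  have := this hx
  simp only [hθ.zero] at this
  linarith

lemma IsPruferPhase.le_self {ν : ℝ} {θ : ℝ → ℝ} (hν : 1 / 2 ≤ ν)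
    (hθ : IsPruferPhase ν θ) {x : ℝ} (hx : 0 ≤ x) : θ x ≤ x := by
  have : Antitone fun x ↦ θ x - x := by
    refine antitone_of_hasDerivAt_nonpos (fun x ↦ (hθ.deriv x).sub (hasDerivAt_id x)) fun x ↦ ?_
    have h2 : 0 ≤ besselEntire ν x ^ 2 / besselNormSq ν x :=
      div_nonneg (sq_nonneg _) (besselNormSq_pos (by linarith) x).le
    have h3 : 0 ≤ ν ^ 2 - 1 / 4 := by nlinarith
    have := mul_nonneg h3 h2
    simp only [Pi.zero_apply]
    linarith
  have := this hx
  simp only [hθ.zero] at this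
  linarith

/-- The amplitude of `√x J_ν`, up to a constant, has a positive limit. -/
lemma exists_amplitude_limit {ν : ℝ} (hν : -(1 / 2) < ν) :
    ∃ r : ℝ, 0 < r ∧ Tendsto (fun x ↦ x ^ (ν - 1 / 2) * √(besselNormSq ν x)) atTop (𝓝 r) := by
  have hν1 : -1 < ν := by linarith
  set p : ℝ → ℝ := fun x ↦ x * besselEntire ν x
  set q : ℝ → ℝ := fun x ↦ x * besselEntire' ν x + (ν + 1 / 2) * besselEntire ν x
  have hN : ∀ x, besselNormSq ν x = p x ^ 2 + q x ^ 2 := fun x ↦ rfl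
  -- The logarithm of the amplitude has derivative O(1/x²), because |pq| ≤ p² + q².
  have hder : ∀ x, 1 ≤ x → HasDerivAt (fun x ↦ (ν - 1 / 2) * Real.log x
      + Real.log (besselNormSq ν x) / 2)
      ((ν ^ 2 - 1 / 4) / x ^ 2 * (p x * q x / besselNormSq ν x)) x := by
    intro x hx
    have hx0 : x ≠ 0 := by positivity
    have hg := hasDerivAt_besselEntire_eq hν1 x
    have hp := (hasDerivAt_id x).mul hg
    have hq := (hasDerivAt_mul_besselEntire' hν1 x).add (hg.const_mul (ν + 1 / 2))
    have hN' : HasDerivAt (besselNormSq ν) _ x := (hp.pow 2).add (hq.pow 2)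
    have hne := (besselNormSq_pos hν x).ne'
    refine (((Real.hasDerivAt_log hx0).const_mul (ν - 1 / 2)).add
      ((hN'.log hne).div_const 2)).congr_deriv ?_
    simp only [Pi.mul_apply, Pi.add_apply, id, p, q]
    field_simp
    rw [besselNormSq]
    push_cast
    ring
  obtain ⟨l, hl⟩ := exists_limit_of_deriv_bound (M := |ν ^ 2 - 1 / 4|) hder fun x hx ↦ by
    have hpos := besselNormSq_pos hν x
    have h1 : |p x * q x / besselNormSq ν x| ≤ 1 := by
      rw [abs_div, abs_of_pos hpos, div_le_one hpos, hN, abs_le]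
      constructor <;> nlinarith [sq_nonneg (p x + q x), sq_nonneg (p x - q x)]
    rw [abs_mul, abs_div, abs_of_nonneg (sq_nonneg x)]
    exact mul_le_of_le_one_right (by positivity) h1
  refine ⟨Real.exp l, Real.exp_pos l, ?_⟩
  have ht : Tendsto (fun x ↦ (ν - 1 / 2) * Real.log x
      + Real.log (besselNormSq ν x) / 2) atTop (𝓝 l) := by
    rw [tendsto_iff_norm_sub_tendsto_zero]
    refine squeeze_zero' (.of_forall fun _ ↦ norm_nonneg _)
      ((eventually_ge_atTop 1).mono fun x hx ↦ hl x hx) (tendsto_const_nhds.div_atTop tendsto_id)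
  refine ((Real.continuous_exp.tendsto l).comp ht).congr' ?_
  filter_upwards [eventually_gt_atTop 0] with x hx
  have hpos := besselNormSq_pos hν x
  rw [Function.comp, Real.exp_add, Real.rpow_def_of_pos hx, mul_comm (Real.log x),
    ← Real.log_sqrt hpos.le, Real.exp_log (Real.sqrt_pos.mpr hpos)]

/-! ### The Laplace transform of x^ν J_ν -/

lemma integrableOn_rpow_mul_exp_neg {a σ : ℝ} (ha : 0 < a) (hσ : 0 < σ) :
    IntegrableOn (fun x : ℝ ↦ x ^ (a - 1) * Real.exp (-σ * x)) (Ioi 0) := by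
  simpa using integrableOn_rpow_mul_exp_neg_mul_rpow (p := 1) (s := a - 1) (b := σ)
    (by linarith) one_pos hσ

lemma norm_exp_mul_rpow_mul_le {s : ℂ} {σ a M x y : ℝ} (hσ : σ ≤ s.re) (hx : 0 < x)
    (hy : |y| ≤ M) :
    ‖Complex.exp (-(s * x)) * ((x ^ (a - 1) * y : ℝ) : ℂ)‖
      ≤ M * (x ^ (a - 1) * Real.exp (-σ * x)) := by
  have h1 : ‖Complex.exp (-(s * x))‖ ≤ Real.exp (-σ * x) := by
    rw [Complex.norm_exp]
    apply Real.exp_le_exp.mpr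
    simp only [Complex.neg_re, Complex.mul_re, Complex.ofReal_re, Complex.ofReal_im, mul_zero,
      sub_zero, neg_mul, neg_le_neg_iff]
    gcongr
  have h2 : 0 < x ^ (a - 1) := by positivity
  rw [norm_mul, Complex.norm_real, Real.norm_eq_abs, abs_mul, abs_of_pos h2]
  calc _ ≤ Real.exp (-σ * x) * (x ^ (a - 1) * M) := by gcongr
    _ = _ := by ring

lemma aestronglyMeasurable_exp_mul_rpow_mul {u : ℝ → ℝ} (hu : ContinuousOn u (Ioi 0)) (s : ℂ)
    (a : ℝ) : AEStronglyMeasurable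
      (fun x : ℝ ↦ Complex.exp (-(s * x)) * ((x ^ (a - 1) * u x : ℝ) : ℂ))
      (volume.restrict (Ioi 0)) := by
  refine ContinuousOn.aestronglyMeasurable ?_ measurableSet_Ioi
  have h1 : ContinuousOn (fun x : ℝ ↦ x ^ (a - 1)) (Ioi 0) := fun x hx ↦
    (Real.continuousAt_rpow_const x _ (Or.inl (ne_of_gt hx))).continuousWithinAt
  refine ContinuousOn.mul (by fun_prop) (Complex.continuous_ofReal.comp_continuousOn (h1.mul hu))

lemma integrableOn_exp_mul_rpow_mul {u : ℝ → ℝ} {a M : ℝ} {s : ℂ} (ha : 0 < a)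
    (hu : ContinuousOn u (Ioi 0)) (hM : ∀ x, 0 < x → |u x| ≤ M) (hs : 0 < s.re) :
    IntegrableOn (fun x : ℝ ↦ Complex.exp (-(s * x)) * ((x ^ (a - 1) * u x : ℝ) : ℂ))
      (Ioi 0) := by
  refine Integrable.mono' ((integrableOn_rpow_mul_exp_neg ha hs).const_mul M)
    (aestronglyMeasurable_exp_mul_rpow_mul hu s a) ?_
  filter_upwards [ae_restrict_mem measurableSet_Ioi] with x hx
  exact norm_exp_mul_rpow_mul_le le_rfl hx (hM x hx)

/-- The Laplace transform of `x^(a-1) u(x)`. -/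
noncomputable def laplace (a : ℝ) (u : ℝ → ℝ) (s : ℂ) : ℂ :=
  ∫ x in Ioi (0 : ℝ), Complex.exp (-(s * x)) * ((x ^ (a - 1) * u x : ℝ) : ℂ)

lemma hasDerivAt_laplace {u : ℝ → ℝ} {a M : ℝ} {s : ℂ} (ha : 0 < a)
    (hu : ContinuousOn u (Ioi 0)) (hM : ∀ x, 0 < x → |u x| ≤ M) (hs : 0 < s.re) :
    HasDerivAt (laplace a u) (-laplace (a + 1) u s) s := by
  have hset : {z : ℂ | s.re / 2 < z.re} ∈ 𝓝 s :=
    (isOpen_lt continuous_const Complex.continuous_re).mem_nhds (by simp; linarith)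
  have key := (hasDerivAt_integral_of_dominated_loc_of_deriv_le (μ := volume.restrict (Ioi 0))
    (F := fun (z : ℂ) (x : ℝ) ↦ Complex.exp (-(z * x)) * ((x ^ (a - 1) * u x : ℝ) : ℂ))
    (F' := fun (z : ℂ) (x : ℝ) ↦ -(Complex.exp (-(z * x)) * ((x ^ (a + 1 - 1) * u x : ℝ) : ℂ)))
    (x₀ := s) (s := {z : ℂ | s.re / 2 < z.re})
    (bound := fun x ↦ M * (x ^ (a + 1 - 1) * Real.exp (-(s.re / 2) * x))) hset
    (.of_forall fun z ↦ aestronglyMeasurable_exp_mul_rpow_mul hu z a)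
    (integrableOn_exp_mul_rpow_mul ha hu hM hs)
    (aestronglyMeasurable_exp_mul_rpow_mul hu s (a + 1)).neg ?_
    ((integrableOn_rpow_mul_exp_neg (by linarith) (by linarith)).const_mul M) ?_).2
  · rwa [integral_neg] at key
  · filter_upwards [ae_restrict_mem measurableSet_Ioi] with x hx z hz
    rw [norm_neg]
    exact norm_exp_mul_rpow_mul_le (le_of_lt hz) hx (hM x hx)
  · filter_upwards [ae_restrict_mem measurableSet_Ioi] with x hx z hz
    have hx : 0 < x := hx
    have h1 : HasDerivAt (fun z : ℂ ↦ -(z * x)) (-(1 * (x : ℂ))) z :=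
      ((hasDerivAt_id z).mul_const _).neg
    refine (h1.cexp.mul_const _).congr_deriv ?_
    have : x ^ (a + 1 - 1) = x ^ (a - 1) * x := by
      rw [← Real.rpow_add_one hx.ne']; ring_nf
    rw [this]
    push_cast
    ring

/-- `√x (x/2)^(-ν) J_ν(x) x^ν`, which is `√x J_ν(x)` up to a constant factor. -/
noncomputable def besselSqrt (ν x : ℝ) : ℝ := x ^ (ν + 1 / 2) * besselEntire ν x

lemma continuous_besselSqrt {ν : ℝ} (hν : -(1 / 2) < ν) : Continuous (besselSqrt ν) := by
  have h1 := continuous_besselEntire (ν := ν) (by linarith)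
  have h2 : Continuous fun x : ℝ ↦ x ^ (ν + 1 / 2) := Real.continuous_rpow_const (by linarith)
  unfold besselSqrt
  fun_prop

lemma IsPruferPhase.besselSqrt_eq {ν x : ℝ} {θ : ℝ → ℝ} (hθ : IsPruferPhase ν θ) (hx : 0 < x) :
    besselSqrt ν x = x ^ (ν - 1 / 2) * √(besselNormSq ν x) * Real.sin (θ x) := by
  have : x ^ (ν + 1 / 2) = x ^ (ν - 1 / 2) * x := by
    rw [← Real.rpow_add_one hx.ne']; ring_nf
  rw [besselSqrt, this, mul_assoc, hθ.sin x, mul_assoc]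

lemma exists_abs_besselSqrt_le {ν : ℝ} (hν : -(1 / 2) < ν) :
    ∃ M, ∀ x, 0 < x → |besselSqrt ν x| ≤ M := by
  obtain ⟨θ, hθ⟩ := exists_isPruferPhase hν
  obtain ⟨r, hr, hlim⟩ := exists_amplitude_limit hν
  obtain ⟨X, hX⟩ := eventually_atTop.mp (hlim.eventually (ge_mem_nhds (lt_add_one r)))
  obtain ⟨M, hM⟩ := (isCompact_Icc (a := (0 : ℝ)) (b := X)).exists_bound_of_continuousOn
    (continuous_besselSqrt hν).continuousOn
  refine ⟨max M (r + 1), fun x hx ↦ ?_⟩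
  rcases le_total x X with h | h
  · exact (hM x ⟨hx.le, h⟩).trans (le_max_left _ _)
  · refine le_trans ?_ (le_max_right _ _)
    rw [hθ.besselSqrt_eq hx, abs_mul, abs_of_nonneg (by positivity)]
    exact (mul_le_of_le_one_right (by positivity) (Real.abs_sin_le_one _)).trans (hX x h)

/-- Controls the boundary term at infinity in the integration by parts behind
`laplace_besselSqrt_ode`. -/
lemma exists_abs_rpow_mul_besselEntire'_le {ν : ℝ} (hν : -(1 / 2) < ν) :
    ∃ M X, ∀ x, X ≤ x → |x ^ (ν + 1 / 2) * besselEntire' ν x| ≤ M := by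
  obtain ⟨θ, hθ⟩ := exists_isPruferPhase hν
  obtain ⟨r, hr, hlim⟩ := exists_amplitude_limit hν
  obtain ⟨X, hX⟩ := eventually_atTop.mp (hlim.eventually (ge_mem_nhds (lt_add_one r)))
  obtain ⟨M, hM⟩ := exists_abs_besselSqrt_le hν
  refine ⟨(r + 1) + (ν + 1 / 2) * M, max X 1, fun x hx ↦ ?_⟩
  have hx1 : 1 ≤ x := (le_max_right _ _).trans hx
  have hx0 : 0 < x := by linarith
  have h1 : x ^ (ν + 1 / 2) = x ^ (ν - 1 / 2) * x := by
    rw [← Real.rpow_add_one hx0.ne']; ring_nf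
  have e : x ^ (ν + 1 / 2) * besselEntire' ν x
      = x ^ (ν - 1 / 2) * √(besselNormSq ν x) * Real.cos (θ x)
        - (ν + 1 / 2) * (besselSqrt ν x / x) := by
    rw [mul_assoc, ← hθ.cos x, besselSqrt, h1]
    field_simp
    ring
  rw [e]
  refine (abs_sub _ _).trans (add_le_add ?_ ?_)
  · rw [abs_mul, abs_of_nonneg (by positivity)]
    exact (mul_le_of_le_one_right (by positivity) (Real.abs_cos_le_one _)).trans
      (hX x ((le_max_left _ _).trans hx))
  · have h2 : 0 ≤ ν + 1 / 2 := by linarith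
    rw [abs_mul, abs_of_nonneg h2, abs_div, abs_of_pos hx0]
    gcongr
    exact (div_le_self (abs_nonneg _) hx1).trans (hM x hx0)

/-- The differential equation of the Laplace transform of `x^ν J_ν(x)`. -/
lemma laplace_besselSqrt_ode {ν : ℝ} (hν : -(1 / 2) < ν) {s : ℂ} (hs : 0 < s.re) :
    (s ^ 2 + 1) * laplace (ν + 1 / 2 + 1) (besselSqrt ν) s
      = (2 * ν + 1) * s * laplace (ν + 1 / 2) (besselSqrt ν) s := by
  have hν1 : -1 < ν := by linarith
  obtain ⟨M, hM⟩ := exists_abs_besselSqrt_le hν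
  obtain ⟨M', X, hM'⟩ := exists_abs_rpow_mul_besselEntire'_le hν
  have huc := (continuous_besselSqrt hν).continuousOn (s := Ioi 0)
  have hi0 := integrableOn_exp_mul_rpow_mul (a := ν + 1 / 2) (by linarith) huc hM hs
  have hi1 := integrableOn_exp_mul_rpow_mul (a := ν + 1 / 2 + 1) (by linarith) huc hM hs
  have hgc := continuous_besselEntire hν1
  have hg'c := continuous_besselEntire' hν1
  -- By (x^(2ν+1) g')' = -x^(2ν+1) g, the derivative of `G` is exactly the difference of the two
  -- integrands; `G` vanishes at 0 and at infinity.
  set G : ℝ → ℂ := fun x ↦ Complex.exp (-(s * x)) *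
    (((x ^ (2 * ν + 1) * besselEntire' ν x : ℝ) : ℂ)
      + s * ((x ^ (2 * ν + 1) * besselEntire ν x : ℝ) : ℂ))
  have hpow : Continuous fun x : ℝ ↦ x ^ (2 * ν + 1) := Real.continuous_rpow_const (by linarith)
  have hGc : Continuous G := by fun_prop
  have hG0 : G 0 = 0 := by simp [G, Real.zero_rpow (show 2 * ν + 1 ≠ 0 by linarith)]
  have hGd : ∀ x ∈ Ioi (0 : ℝ), HasDerivAt G
      ((2 * ν + 1) * s * (Complex.exp (-(s * x))
          * ((x ^ (ν + 1 / 2 - 1) * besselSqrt ν x : ℝ) : ℂ))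
        - (s ^ 2 + 1) * (Complex.exp (-(s * x))
          * ((x ^ (ν + 1 / 2 + 1 - 1) * besselSqrt ν x : ℝ) : ℂ))) x := by
    intro x hx
    have hx : 0 < x := hx
    have h1 : HasDerivAt (fun x : ℝ ↦ Complex.exp (-(s * x)))
        (Complex.exp (-(s * x)) * (-(s * (1 : ℝ)))) x :=
      (((hasDerivAt_id x).ofReal_comp.const_mul s).neg).cexp
    have hw := (Real.hasDerivAt_rpow_const (p := 2 * ν) (Or.inl hx.ne')).mul
      (hasDerivAt_mul_besselEntire' hν1 x)
    have hgd := (Real.hasDerivAt_rpow_const (p := 2 * ν + 1) (Or.inl hx.ne')).mul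
      (hasDerivAt_besselEntire_eq hν1 x)
    have e1 : x ^ (2 * ν + 1) = x ^ (2 * ν) * x := Real.rpow_add_one hx.ne' _
    have hw' : HasDerivAt (fun x ↦ x ^ (2 * ν + 1) * besselEntire' ν x) _ x :=
      hw.congr_of_eventuallyEq (by
        filter_upwards [lt_mem_nhds hx] with y hy
        rw [Real.rpow_add_one (ne_of_gt hy)]
        simp only [Pi.mul_apply]
        ring)
    refine (h1.mul (hw'.ofReal_comp.add (hgd.ofReal_comp.const_mul s))).congr_deriv ?_
    have e2 : x ^ (2 * ν - 1) * x = x ^ (2 * ν) := by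
      rw [← Real.rpow_add_one hx.ne']; ring_nf
    have e3 : x ^ (ν + 1 / 2 - 1) * besselSqrt ν x = x ^ (2 * ν) * besselEntire ν x := by
      rw [besselSqrt, ← mul_assoc, ← Real.rpow_add hx]; ring_nf
    have e4 : x ^ (ν + 1 / 2 + 1 - 1) * besselSqrt ν x
        = x ^ (2 * ν) * x * besselEntire ν x := by
      rw [besselSqrt, ← mul_assoc, ← Real.rpow_add hx, ← e1]; ring_nf
    have e5 : 2 * ν + 1 - 1 = 2 * ν := by ring
    simp only [Pi.mul_apply, Pi.add_apply]
    rw [e3, e4, e5, e1, ← e2]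
    push_cast
    ring
  have hGlim : Tendsto G atTop (𝓝 0) := by
    have hb := (tendsto_rpow_mul_exp_neg_mul_atTop_nhds_zero (ν + 1 / 2) s.re hs).const_mul
      (M' + ‖s‖ * M)
    rw [mul_zero] at hb
    refine squeeze_zero_norm' ?_ hb
    filter_upwards [eventually_ge_atTop X, eventually_gt_atTop 0] with x hx hx0
    have hexp : ‖Complex.exp (-(s * x))‖ = Real.exp (-s.re * x) := by
      rw [Complex.norm_exp]; simp
    have e1 : x ^ (2 * ν + 1) = x ^ (ν + 1 / 2) * x ^ (ν + 1 / 2) := by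
      rw [← Real.rpow_add hx0]; ring_nf
    have hp : 0 ≤ x ^ (ν + 1 / 2) := by positivity
    simp only [G]
    rw [norm_mul, hexp, e1, mul_assoc, mul_assoc, Complex.ofReal_mul (x ^ _),
      Complex.ofReal_mul (x ^ _) (x ^ _ * besselEntire ν x)]
    have : ‖((x ^ (ν + 1 / 2) : ℝ) : ℂ) * ((x ^ (ν + 1 / 2) * besselEntire' ν x : ℝ) : ℂ)
        + s * (((x ^ (ν + 1 / 2) : ℝ) : ℂ) * ((x ^ (ν + 1 / 2) * besselEntire ν x : ℝ) : ℂ))‖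
        ≤ x ^ (ν + 1 / 2) * (M' + ‖s‖ * M) := by
      refine (norm_add_le _ _).trans ?_
      rw [norm_mul, norm_mul, norm_mul, Complex.norm_real, Complex.norm_real, Complex.norm_real,
        Real.norm_of_nonneg hp, Real.norm_eq_abs, Real.norm_eq_abs]
      have h1 := hM' x hx
      have h2 : |x ^ (ν + 1 / 2) * besselEntire ν x| ≤ M := hM x hx0
      calc _ ≤ x ^ (ν + 1 / 2) * M' + ‖s‖ * (x ^ (ν + 1 / 2) * M) := by gcongr
        _ = _ := by ring
    calc _ ≤ Real.exp (-s.re * x) * (x ^ (ν + 1 / 2) * (M' + ‖s‖ * M)) := by gcongr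
      _ = _ := by ring
  have hint := integral_Ioi_of_hasDerivAt_of_tendsto hGc.continuousWithinAt hGd
    ((hi0.const_mul _).sub (hi1.const_mul _)) hGlim
  rw [hG0, sub_zero, integral_sub (hi0.const_mul _) (hi1.const_mul _), integral_const_mul,
    integral_const_mul] at hint
  exact (sub_eq_zero.mp hint).symm

lemma one_add_sq_mem_slitPlane {s : ℂ} (hs : 0 < s.re) : 1 + s ^ 2 ∈ Complex.slitPlane := by
  rw [Complex.mem_slitPlane_iff]
  by_cases h : s.im = 0
  · left
    simp [pow_two, h]
    positivity
  · right
    simp [pow_two]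
    intro h'
    have : s.re * s.im = 0 := by linarith
    exact (mul_ne_zero hs.ne' h) this

/-- The Laplace transform of `x^ν J_ν(x)` is a real multiple of `(1 + s²)^(-ν - 1/2)`. -/
lemma exists_laplace_besselSqrt_eq {ν : ℝ} (hν : -(1 / 2) < ν) :
    ∃ κ : ℝ, ∀ s : ℂ, 0 < s.re →
      laplace (ν + 1 / 2) (besselSqrt ν) s * (1 + s ^ 2) ^ ((ν + 1 / 2 : ℝ) : ℂ) = κ := by
  obtain ⟨M, hM⟩ := exists_abs_besselSqrt_le hν
  have huc := (continuous_besselSqrt hν).continuousOn (s := Ioi 0)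
  set Φ : ℂ → ℂ := fun s ↦
    laplace (ν + 1 / 2) (besselSqrt ν) s * (1 + s ^ 2) ^ ((ν + 1 / 2 : ℝ) : ℂ)
  have hd : ∀ s : ℂ, 0 < s.re → HasDerivAt Φ 0 s := by
    intro s hs
    have hmem := one_add_sq_mem_slitPlane hs
    have h1 := hasDerivAt_laplace (a := ν + 1 / 2) (by linarith) huc hM hs
    have h2 : HasDerivAt (fun s : ℂ ↦ 1 + s ^ 2) (2 * s) s := by
      simpa using (hasDerivAt_pow 2 s).const_add 1
    refine (h1.mul (h2.cpow_const (c := ((ν + 1 / 2 : ℝ) : ℂ)) hmem)).congr_deriv ?_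
    have hode := laplace_besselSqrt_ode hν hs
    have hne : 1 + s ^ 2 ≠ 0 := Complex.slitPlane_ne_zero hmem
    have hc : (1 + s ^ 2) ^ ((ν + 1 / 2 : ℝ) : ℂ)
        = (1 + s ^ 2) ^ (((ν + 1 / 2 : ℝ) : ℂ) - 1) * (1 + s ^ 2) := by
      nth_rewrite 3 [← Complex.cpow_one (1 + s ^ 2)]
      rw [← Complex.cpow_add _ _ hne]; ring_nf
    rw [hc]
    push_cast
    linear_combination (-(1 + s ^ 2) ^ ((ν : ℂ) + 1 / 2 - 1)) * hode
  have hconst : ∀ s : ℂ, 0 < s.re → Φ s = Φ 1 := by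
    intro s hs
    have ho : IsOpen {z : ℂ | 0 < z.re} := isOpen_lt continuous_const Complex.continuous_re
    exact ho.is_const_of_deriv_eq_zero (convex_halfSpace_re_gt 0).isPreconnected
      (fun z hz ↦ (hd z hz).differentiableAt.differentiableWithinAt) (fun z hz ↦ (hd z hz).deriv)
      hs (by simp)
  -- The constant is evaluated at s = 1, where it is visibly real. Only this reality is used later:
  -- it determines the phase modulo π.
  refine ⟨(∫ x in Ioi (0 : ℝ), Real.exp (-x) * (x ^ (ν + 1 / 2 - 1) * besselSqrt ν x))
    * 2 ^ (ν + 1 / 2), fun s hs ↦ (hconst s hs).trans ?_⟩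
  simp only [Φ, laplace]
  rw [Complex.ofReal_mul, ← integral_complex_ofReal, Complex.ofReal_cpow (by norm_num)]
  push_cast
  norm_num

/-! ### The asymptotic phase modulo π -/

/-- Abelian theorem: the behaviour of the Laplace transform at `i + ε` for a function asymptotic to
`r x^(a-1) sin (x + c)`. -/
lemma tendsto_rpow_mul_laplace {u : ℝ → ℝ} {a M r c : ℝ} (ha : 0 < a)
    (hu : Continuous u) (hM : ∀ x, 0 < x → |u x| ≤ M)
    (hlim : Tendsto (fun x ↦ u x - r * Real.sin (x + c)) atTop (𝓝 0)) :
    Tendsto (fun T : ℝ ↦ ((T⁻¹ ^ a : ℝ) : ℂ) * laplace a u ((T⁻¹ : ℝ) + Complex.I)) atTop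
      (𝓝 (r * Complex.exp (c * Complex.I) / (2 * Complex.I) * Real.Gamma a)) := by
  set w : ℝ → ℝ := fun t ↦ t ^ (a - 1) * Real.exp (-t) with hw
  have hwint : IntegrableOn w (Ioi 0) := by
    simpa [hw] using integrableOn_rpow_mul_exp_neg ha one_pos
  set e : ℝ → ℝ := fun x ↦ u x - r * Real.sin (x + c) with he
  have hec : Continuous e := by fun_prop
  have heM : ∀ x, 0 < x → |e x| ≤ M + |r| := fun x hx ↦ by
    refine (abs_sub _ _).trans (add_le_add (hM x hx) ?_)
    rw [abs_mul]
    exact mul_le_of_le_one_right (abs_nonneg _) (Real.abs_sin_le_one _)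
  -- `K` is the non-oscillating part of e^(-ix) r sin(x + c), the only one that survives in the
  -- limit; `K'` is the coefficient of e^(-2ix).
  set K : ℂ := r * Complex.exp (c * Complex.I) / (2 * Complex.I)
  set K' : ℂ := -(r * Complex.exp (-(c * Complex.I)) / (2 * Complex.I))
  have hwc : ContinuousOn w (Ioi 0) := by
    have h1 : ContinuousOn (fun x : ℝ ↦ x ^ (a - 1)) (Ioi 0) := fun x hx ↦
      (Real.continuousAt_rpow_const x _ (Or.inl (ne_of_gt hx))).continuousWithinAt
    exact h1.mul (by fun_prop)
  have hwcC : ContinuousOn (fun t ↦ (w t : ℂ)) (Ioi 0) :=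
    Complex.continuous_ofReal.comp_continuousOn hwc
  have hwintC : IntegrableOn (fun t ↦ (w t : ℂ)) (Ioi 0) := hwint.ofReal
  -- the scaled transform
  have hscale : ∀ T : ℝ, 0 < T → ((T⁻¹ ^ a : ℝ) : ℂ) * laplace a u ((T⁻¹ : ℝ) + Complex.I)
      = ∫ t in Ioi (0 : ℝ), (w t : ℂ) * (Complex.exp (-(T * t * Complex.I)) * u (T * t)) := by
    intro T hT
    have h1 := integral_comp_mul_left_Ioi (fun x : ℝ ↦
      Complex.exp (-((((T⁻¹ : ℝ) : ℂ) + Complex.I) * x)) * ((x ^ (a - 1) * u x : ℝ) : ℂ)) 0 hT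
    rw [mul_zero] at h1
    have h2 : laplace a u ((T⁻¹ : ℝ) + Complex.I) = (T : ℂ) * ∫ t in Ioi (0 : ℝ),
        Complex.exp (-((((T⁻¹ : ℝ) : ℂ) + Complex.I) * ((T * t : ℝ) : ℂ)))
          * (((T * t) ^ (a - 1) * u (T * t) : ℝ) : ℂ) := by
      rw [h1, laplace, Complex.real_smul, ← mul_assoc, ← Complex.ofReal_mul,
        mul_inv_cancel₀ hT.ne', Complex.ofReal_one, one_mul]
    rw [h2, ← mul_assoc, ← integral_const_mul]
    refine setIntegral_congr_fun measurableSet_Ioi fun t ht ↦ ?_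
    have ht : 0 < t := ht
    have h3 : T⁻¹ ^ a * T * (T * t) ^ (a - 1) = t ^ (a - 1) := by
      rw [Real.mul_rpow hT.le ht.le, Real.rpow_sub_one hT.ne', Real.inv_rpow hT.le]
      have : T ^ a ≠ 0 := by positivity
      field_simp
    have h4 : -((((T⁻¹ : ℝ) : ℂ) + Complex.I) * ((T * t : ℝ) : ℂ))
        = ((-t : ℝ) : ℂ) + -(T * t * Complex.I) := by
      have : (T : ℂ) ≠ 0 := by exact_mod_cast hT.ne'
      push_cast
      field_simp
      ring
    simp only [hw]
    rw [h4, Complex.exp_add, ← Complex.ofReal_exp, ← h3]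
    push_cast
    ring
  -- the decomposition of the oscillating factor
  have hdec : ∀ x : ℝ, Complex.exp (-(x * Complex.I)) * u x
      = K + K' * Complex.exp (-(2 * x * Complex.I)) + Complex.exp (-(x * Complex.I)) * e x := by
    intro x
    have h1 : ((u x : ℝ) : ℂ) = r * Complex.sin (x + c) + e x := by
      simp only [he]; push_cast; ring
    have h2 : Complex.exp (-(x * Complex.I)) * Complex.exp (x * Complex.I) = 1 := by
      rw [← Complex.exp_add]; simp
    have h3 : Complex.exp (-(2 * x * Complex.I))
        = Complex.exp (-(x * Complex.I)) * Complex.exp (-(x * Complex.I)) := by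
      rw [← Complex.exp_add]; ring_nf
    have h4 : Complex.sin (x + c) = (Complex.exp (x * Complex.I) * Complex.exp (c * Complex.I)
        - Complex.exp (-(x * Complex.I)) * Complex.exp (-(c * Complex.I))) / (2 * Complex.I) := by
      rw [Complex.sin, ← Complex.exp_add, ← Complex.exp_add]
      have hI : Complex.I ≠ 0 := Complex.I_ne_zero
      field_simp
      ring_nf
      simp only [Complex.I_sq]
      ring_nf
    rw [h1, h4, h3]
    simp only [K, K']
    linear_combination (r * Complex.exp (c * Complex.I) / (2 * Complex.I)) * h2
  have hpart1 : ∫ t in Ioi (0 : ℝ), (w t : ℂ) * K = K * Real.Gamma a := by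
    rw [integral_mul_const, integral_complex_ofReal, Real.Gamma_eq_integral ha, mul_comm]
    simp only [hw, mul_comm]
  -- Riemann–Lebesgue. The frequency is T/π because the Fourier character is e^(2πi·).
  have hpart2 : Tendsto (fun T : ℝ ↦ ∫ t in Ioi (0 : ℝ),
      (w t : ℂ) * (K' * Complex.exp (-(2 * ((T * t : ℝ) : ℂ) * Complex.I)))) atTop (𝓝 0) := by
    have h1 := (Real.tendsto_integral_exp_smul_cocompact
      (fun t : ℝ ↦ (Ioi (0 : ℝ)).indicator (fun t ↦ (w t : ℂ) * K') t)).comp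
      ((tendsto_id.atTop_div_const Real.pi_pos).mono_right atTop_le_cocompact)
    refine h1.congr fun T ↦ ?_
    rw [← integral_indicator measurableSet_Ioi]
    simp only [Function.comp, id]
    refine integral_congr_ae (.of_forall fun t ↦ ?_)
    by_cases ht : t ∈ Ioi (0 : ℝ)
    · simp only [indicator_of_mem ht]
      rw [Circle.smul_def, Real.fourierChar_apply, smul_eq_mul]
      have : ((2 * Real.pi * -(t * (T / Real.pi)) : ℝ) : ℂ) * Complex.I
          = -(2 * ((T * t : ℝ) : ℂ) * Complex.I) := by
        have : (Real.pi : ℂ) ≠ 0 := by exact_mod_cast Real.pi_ne_zero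
        push_cast
        field_simp
      rw [this]
      ring
    · simp [indicator_of_notMem ht]
  have hmeas3 : ∀ T : ℝ, AEStronglyMeasurable (fun t : ℝ ↦
      (w t : ℂ) * (Complex.exp (-(((T * t : ℝ) : ℂ) * Complex.I)) * e (T * t)))
      (volume.restrict (Ioi 0)) := fun T ↦
    (hwcC.mul (by fun_prop)).aestronglyMeasurable measurableSet_Ioi
  have hbound3 : ∀ T : ℝ, 0 < T → ∀ t ∈ Ioi (0 : ℝ),
      ‖(w t : ℂ) * (Complex.exp (-(((T * t : ℝ) : ℂ) * Complex.I)) * e (T * t))‖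
        = w t * |e (T * t)| := by
    intro T hT t ht
    have ht : 0 < t := ht
    have h1 : ‖Complex.exp (-(((T * t : ℝ) : ℂ) * Complex.I))‖ = 1 := by
      rw [Complex.norm_exp]; simp
    rw [norm_mul, norm_mul, h1, one_mul, Complex.norm_real, Complex.norm_real,
      Real.norm_of_nonneg (by positivity), Real.norm_eq_abs]
  have hpart3 : Tendsto (fun T : ℝ ↦ ∫ t in Ioi (0 : ℝ),
      (w t : ℂ) * (Complex.exp (-(((T * t : ℝ) : ℂ) * Complex.I)) * e (T * t))) atTop (𝓝 0) := by
    have h0 : (0 : ℂ) = ∫ t in Ioi (0 : ℝ), (0 : ℂ) := by simp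
    rw [h0]
    refine tendsto_integral_filter_of_dominated_convergence (fun t ↦ w t * (M + |r|))
      (.of_forall hmeas3) ?_ (hwint.mul_const _) ?_
    · filter_upwards [eventually_gt_atTop 0] with T hT
      filter_upwards [ae_restrict_mem measurableSet_Ioi] with t ht
      have ht' : 0 < t := ht
      rw [hbound3 T hT t ht]
      have : 0 ≤ w t := by positivity
      gcongr
      exact heM _ (by positivity)
    · filter_upwards [ae_restrict_mem measurableSet_Ioi] with t ht
      have ht' : 0 < t := ht
      rw [tendsto_zero_iff_norm_tendsto_zero]
      have h1 := (hlim.comp (tendsto_id.atTop_mul_const ht')).abs.const_mul (w t)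
      rw [abs_zero, mul_zero] at h1
      refine h1.congr' ?_
      filter_upwards [eventually_gt_atTop 0] with T hT
      rw [hbound3 T hT t ht]
      rfl
  have hsum := (hpart2.add hpart3).const_add (K * Real.Gamma a)
  rw [add_zero, add_zero] at hsum
  refine hsum.congr' ?_
  filter_upwards [eventually_gt_atTop 0] with T hT
  have hi1 : IntegrableOn (fun t ↦ (w t : ℂ) * K) (Ioi 0) := hwintC.mul_const K
  have hi2 : IntegrableOn (fun t : ℝ ↦
      (w t : ℂ) * (K' * Complex.exp (-(2 * ((T * t : ℝ) : ℂ) * Complex.I)))) (Ioi 0) := by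
    refine Integrable.mono' (hwint.mul_const ‖K'‖)
      ((hwcC.mul (by fun_prop)).aestronglyMeasurable measurableSet_Ioi) ?_
    filter_upwards [ae_restrict_mem measurableSet_Ioi] with t ht
    have ht' : 0 < t := ht
    have h1 : ‖Complex.exp (-(2 * ((T * t : ℝ) : ℂ) * Complex.I))‖ = 1 := by
      rw [Complex.norm_exp]; simp
    rw [norm_mul, norm_mul, h1, mul_one, Complex.norm_real, Real.norm_of_nonneg (by positivity)]
  have hi3 : IntegrableOn (fun t : ℝ ↦
      (w t : ℂ) * (Complex.exp (-(((T * t : ℝ) : ℂ) * Complex.I)) * e (T * t))) (Ioi 0) := by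
    refine Integrable.mono' (hwint.mul_const (M + |r|)) (hmeas3 T) ?_
    filter_upwards [ae_restrict_mem measurableSet_Ioi] with t ht
    have ht' : 0 < t := ht
    rw [hbound3 T hT t ht]
    have : 0 ≤ w t := by positivity
    gcongr
    exact heM _ (by positivity)
  have hi23 : IntegrableOn (fun t : ℝ ↦
      (w t : ℂ) * (K' * Complex.exp (-(2 * ((T * t : ℝ) : ℂ) * Complex.I)))
        + (w t : ℂ) * (Complex.exp (-(((T * t : ℝ) : ℂ) * Complex.I)) * e (T * t))) (Ioi 0) :=
    hi2.add hi3
  rw [hscale T hT, ← hpart1, ← integral_add hi2 hi3, ← integral_add hi1 hi23]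
  refine setIntegral_congr_fun measurableSet_Ioi fun t _ ↦ ?_
  have := hdec (T * t)
  push_cast at this ⊢
  rw [this]
  ring

/-- The asymptotic phase of `J_ν`, modulo `π`. -/
lemma IsPruferPhase.sin_limit_eq_zero {ν c : ℝ} {θ : ℝ → ℝ} (hν : -(1 / 2) < ν)
    (hθ : IsPruferPhase ν θ) (hc : Tendsto (fun x ↦ θ x - x - c) atTop (𝓝 0)) :
    Real.sin (c - Real.pi / 4 + Real.pi * ν / 2) = 0 := by
  obtain ⟨r, hr, hrlim⟩ := exists_amplitude_limit hν
  obtain ⟨M, hM⟩ := exists_abs_besselSqrt_le hν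
  obtain ⟨κ, hκ⟩ := exists_laplace_besselSqrt_eq hν
  set a := ν + 1 / 2 with ha_def
  have ha : 0 < a := by linarith
  have hlim : Tendsto (fun x ↦ besselSqrt ν x - r * Real.sin (x + c)) atTop (𝓝 0) := by
    set A : ℝ → ℝ := fun x ↦ x ^ (ν - 1 / 2) * √(besselNormSq ν x)
    have h1 : Tendsto (fun x ↦ |A x - r| + |r| * |θ x - x - c|) atTop (𝓝 0) := by
      have h2 := (hrlim.sub_const r).abs
      have h3 := hc.abs.const_mul |r|
      simpa using h2.add h3
    refine squeeze_zero_norm' ?_ h1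
    filter_upwards [eventually_gt_atTop 0] with x hx
    rw [hθ.besselSqrt_eq hx, Real.norm_eq_abs]
    have e : A x * Real.sin (θ x) - r * Real.sin (x + c)
        = (A x - r) * Real.sin (θ x) + r * (Real.sin (θ x) - Real.sin (x + c)) := by ring
    change |A x * Real.sin (θ x) - r * Real.sin (x + c)| ≤ _
    rw [e]
    refine (abs_add_le _ _).trans (add_le_add ?_ ?_)
    · rw [abs_mul]
      exact mul_le_of_le_one_right (abs_nonneg _) (Real.abs_sin_le_one _)
    · have := Real.abs_sin_sub_sin_le (θ x) (x + c)
      rw [sub_add_eq_sub_sub] at this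
      rw [abs_mul]
      exact mul_le_mul_of_nonneg_left this (abs_nonneg _)
  have hmain := tendsto_rpow_mul_laplace ha (continuous_besselSqrt hν) hM hlim
  have h2I : (2 * Complex.I) ∈ Complex.slitPlane := by
    rw [Complex.mem_slitPlane_iff]; right; simp
  have hpow : Tendsto (fun T : ℝ ↦ (((T⁻¹ : ℝ) : ℂ) + 2 * Complex.I) ^ (a : ℂ)) atTop
      (𝓝 ((2 * Complex.I) ^ (a : ℂ))) := by
    have h1 : Tendsto (fun T : ℝ ↦ ((T⁻¹ : ℝ) : ℂ) + 2 * Complex.I) atTop (𝓝 (2 * Complex.I)) := by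
      have := (Complex.continuous_ofReal.tendsto 0).comp tendsto_inv_atTop_zero
      simpa using this.add_const (2 * Complex.I)
    exact (continuousAt_cpow_const h2I).tendsto.comp h1
  have hprod := hmain.mul hpow
  have hconst : (r * Complex.exp (c * Complex.I) / (2 * Complex.I) * Real.Gamma a)
      * (2 * Complex.I) ^ (a : ℂ) = κ := by
    refine tendsto_nhds_unique hprod (tendsto_const_nhds.congr' ?_)
    filter_upwards [eventually_gt_atTop 0] with T hT
    have hT' : 0 < T⁻¹ := inv_pos.mpr hT
    rw [← hκ ((T⁻¹ : ℝ) + Complex.I) (by simpa using hT)]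
    -- Near s = i the factor T⁻¹ is positive, so it splits off the principal power and cancels the
    -- scaling of the Abelian theorem.
    have e1 : (1 : ℂ) + (((T⁻¹ : ℝ) : ℂ) + Complex.I) ^ 2
        = ((T⁻¹ : ℝ) : ℂ) * (((T⁻¹ : ℝ) : ℂ) + 2 * Complex.I) := by
      linear_combination Complex.I_sq
    have hz : (((T⁻¹ : ℝ) : ℂ) + 2 * Complex.I) ≠ 0 := by
      intro h
      have := congrArg Complex.im h
      simp at this
    have hz' : ((T⁻¹ : ℝ) : ℂ) ≠ 0 := by exact_mod_cast hT'.ne'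
    have e2 : (((T⁻¹ : ℝ) : ℂ) * (((T⁻¹ : ℝ) : ℂ) + 2 * Complex.I)) ^ (a : ℂ)
        = ((T⁻¹ ^ a : ℝ) : ℂ) * (((T⁻¹ : ℝ) : ℂ) + 2 * Complex.I) ^ (a : ℂ) := by
      rw [Complex.cpow_def_of_ne_zero (mul_ne_zero hz' hz), Complex.log_ofReal_mul hT' hz,
        add_mul, Complex.exp_add, ← Complex.cpow_def_of_ne_zero hz, Real.rpow_def_of_pos hT']
      push_cast
      rfl
    rw [e1, e2]
    ring
  have hcpow : (2 * Complex.I) ^ (a : ℂ)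
      = ((2 ^ a : ℝ) : ℂ) * Complex.exp (((a * (Real.pi / 2) : ℝ) : ℂ) * Complex.I) := by
    have h2 : (2 * Complex.I : ℂ) = ((2 : ℝ) : ℂ) * Complex.I := by norm_num
    rw [h2, Complex.cpow_def_of_ne_zero (by simp [Complex.I_ne_zero]),
      Complex.log_ofReal_mul two_pos Complex.I_ne_zero, Complex.log_I, add_mul, Complex.exp_add,
      Real.rpow_def_of_pos two_pos]
    push_cast
    ring_nf
  rw [hcpow] at hconst
  have hG := Real.Gamma_pos_of_pos ha
  have h2a : (0 : ℝ) < 2 ^ a := by positivity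
  -- The argument of the left side of `hconst` is c - π/2 + aπ/2 = c - π/4 + πν/2, while κ is real;
  -- the imaginary part gives the claim.
  have hfin : ((r * Real.Gamma a * 2 ^ a : ℝ) : ℂ)
      * Complex.exp (((c - Real.pi / 4 + Real.pi * ν / 2 : ℝ) : ℂ) * Complex.I)
      = ((2 * κ : ℝ) : ℂ) := by
    have e1 : ((c - Real.pi / 4 + Real.pi * ν / 2 : ℝ) : ℂ) * Complex.I
        = c * Complex.I + ((a * (Real.pi / 2) : ℝ) : ℂ) * Complex.I
          + -(Real.pi / 2 * Complex.I) := by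
      rw [ha_def]; push_cast; ring
    have e2 : Complex.exp (-(Real.pi / 2 * Complex.I)) = 1 / Complex.I := by
      rw [Complex.exp_neg, Complex.exp_pi_div_two_mul_I, one_div]
    rw [e1, Complex.exp_add, Complex.exp_add, e2]
    push_cast at hconst ⊢
    rw [← hconst]
    have hI := Complex.I_ne_zero
    field_simp
  have him := congrArg Complex.im hfin
  rw [Complex.im_ofReal_mul, Complex.exp_ofReal_mul_I_im, Complex.ofReal_im] at him
  exact (mul_eq_zero.mp him).resolve_left (by positivity)

/-! ### Growth of ψ and the exact multiple of π -/

lemma IsDerivPhase.tendsto_atTop {ν : ℝ} {ψ : ℝ → ℝ} (hν : -(1 / 2) < ν)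
    (hψ : IsDerivPhase ν ψ) : Tendsto ψ atTop atTop := by
  obtain ⟨θ, hθ⟩ := exists_isPruferPhase hν
  obtain ⟨c, hc⟩ := hθ.exists_limit hν
  -- ψ > θ - 3π/2 by the comparison of angles, and θ - x is bounded below.
  refine tendsto_atTop_mono' atTop ?_ (tendsto_atTop_add_const_right atTop
    (c - |ν ^ 2 - 1 / 4| - 3 * Real.pi / 2) tendsto_id)
  filter_upwards [eventually_ge_atTop 1] with x hx
  have h1 := (abs_le.mp (hc x hx)).1
  have h2 := (abs_lt.mp (hθ.abs_sub_derivPhase_lt hν hψ (by linarith : 0 ≤ x))).2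
  have h3 := div_le_self (abs_nonneg (ν ^ 2 - 1 / 4)) hx
  simp only [id]
  linarith

lemma IsDerivPhase.exists_eq {ν : ℝ} {ψ : ℝ → ℝ} (hν : -(1 / 2) < ν) (hψ : IsDerivPhase ν ψ)
    {y : ℝ} (hy : 0 ≤ y) : ∃ x, 0 ≤ x ∧ ψ x = y := by
  obtain ⟨X, hX0, hX⟩ := ((eventually_ge_atTop 0).and
    ((hψ.tendsto_atTop hν).eventually_ge_atTop y)).exists
  obtain ⟨x, hx, hxy⟩ := intermediate_value_Icc hX0 hψ.continuous.continuousOn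
    (show y ∈ Icc (ψ 0) (ψ X) from ⟨by rw [hψ.zero]; exact hy, hX⟩)
  exact ⟨x, hx.1, hxy⟩

/-- For x > 0, sin θ and sin(ψ + π/2) = cos ψ are both positive multiples of g, so angles less than
π apart lie in the same interval between multiples of π. -/
lemma IsPruferPhase.mem_Ioo_of_derivPhase {ν x : ℝ} {θ ψ : ℝ → ℝ} {k : ℤ} (hν : -(1 / 2) < ν)
    (hθ : IsPruferPhase ν θ) (hψ : IsDerivPhase ν ψ) (hx : 0 < x)
    (h : ψ x + Real.pi / 2 ∈ Ioo (k * Real.pi) ((k + 1) * Real.pi)) :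
    θ x ∈ Ioo (k * Real.pi) ((k + 1) * Real.pi) := by
  refine int_mul_pi_lt_of_sin_pos_iff (hθ.abs_sub_derivPhase_lt hν hψ hx.le) ?_ h
  obtain ⟨R, hR, -, e2⟩ := hψ.polar x
  have hρ := Real.sqrt_pos.mpr (besselNormSq_pos hν x)
  have e3 := hθ.sin x
  set ρ := √(besselNormSq ν x)
  rw [Real.sin_add_pi_div_two]
  have hcos : Real.cos (ψ x) ≠ 0 := by
    rw [← Real.sin_add_pi_div_two]
    intro h0
    obtain ⟨n, hn⟩ := Real.sin_eq_zero_iff.mp h0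
    rw [← hn] at h
    have h1 := lt_of_mul_lt_mul_right h.1 Real.pi_pos.le
    have h2 := lt_of_mul_lt_mul_right h.2 Real.pi_pos.le
    norm_cast at h1 h2
    omega
  have e : Real.sin (θ x) = x * R * Real.cos (ψ x) / ρ := by
    rw [eq_div_iff hρ.ne']; linear_combination -e3 + x * e2
  rw [e]
  have := sq_pos_iff.mpr hcos
  have e' : x * R * Real.cos (ψ x) / ρ * Real.cos (ψ x) = x * R * Real.cos (ψ x) ^ 2 / ρ := by
    ring
  rw [e']
  positivity

/-- The Prüfer phase satisfies `θ(x) = x + π/4 - πν/2 + mπ + O(1/x)`. -/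
def HasPhaseShift (ν : ℝ) (θ : ℝ → ℝ) (m : ℤ) : Prop :=
  ∀ x, 1 ≤ x → |θ x - x - (Real.pi / 4 - Real.pi * ν / 2 + m * Real.pi)| ≤ |ν ^ 2 - 1 / 4| / x

lemma IsPruferPhase.exists_hasPhaseShift {ν : ℝ} {θ : ℝ → ℝ} (hν : -(1 / 2) < ν)
    (hθ : IsPruferPhase ν θ) : ∃ m, HasPhaseShift ν θ m := by
  obtain ⟨c, hc⟩ := hθ.exists_limit hν
  have hlim : Tendsto (fun x ↦ θ x - x - c) atTop (𝓝 0) :=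
    squeeze_zero_norm' ((eventually_ge_atTop 1).mono hc)
      (tendsto_const_nhds.div_atTop tendsto_id)
  obtain ⟨m, hm⟩ := Real.sin_eq_zero_iff.mp (hθ.sin_limit_eq_zero hν hlim)
  refine ⟨m, fun x hx ↦ ?_⟩
  convert hc x hx using 3
  linarith

/-- Far out, the error term of the Prüfer phase is smaller than any given positive number. -/
lemma HasPhaseShift.eventually_abs_lt {ν : ℝ} {θ : ℝ → ℝ} {m : ℤ} (h : HasPhaseShift ν θ m)
    {ε : ℝ} (hε : 0 < ε) : ∀ᶠ x in atTop,
      |θ x - x - (Real.pi / 4 - Real.pi * ν / 2 + m * Real.pi)| < ε := by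
  have hlim : Tendsto (fun x : ℝ ↦ |ν ^ 2 - 1 / 4| / x) atTop (𝓝 0) :=
    tendsto_const_nhds.div_atTop tendsto_id
  filter_upwards [eventually_ge_atTop 1, hlim.eventually_lt_const hε] with x hx h1
  exact (h x hx).trans_lt h1

/-- Far out, x ≤ θ < x + π/2 - πν/2 + mπ, and ν > -1/2 forces m > -1. `HasPhaseShift.nonpos` is the
mirror image: θ ≤ x gives m < ν/2 < 1. -/
lemma HasPhaseShift.nonneg {ν : ℝ} {θ : ℝ → ℝ} {m : ℤ} (hν : -(1 / 2) < ν) (hν2 : ν ≤ 1 / 2)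
    (hθ : IsPruferPhase ν θ) (h : HasPhaseShift ν θ m) : 0 ≤ m := by
  have hπ := Real.pi_pos
  obtain ⟨x, hx, h1⟩ := ((eventually_ge_atTop 0).and
    (h.eventually_abs_lt (ε := Real.pi / 4) (by linarith))).exists
  have h2 := hθ.self_le hν hν2 hx
  have h3 := (abs_lt.mp h1).2
  by_contra hm
  have hm' : (m : ℝ) ≤ -1 := by exact_mod_cast (by omega : m ≤ -1)
  nlinarith

lemma HasPhaseShift.nonpos {ν : ℝ} {θ : ℝ → ℝ} {m : ℤ} (hν : 1 / 2 ≤ ν) (hν2 : ν ≤ 3 / 2)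
    (hθ : IsPruferPhase ν θ) (h : HasPhaseShift ν θ m) : m ≤ 0 := by
  have hπ := Real.pi_pos
  obtain ⟨x, hx, h1⟩ := ((eventually_ge_atTop 0).and
    (h.eventually_abs_lt (ε := Real.pi / 4) (by linarith))).exists
  have h2 := hθ.le_self hν hx
  have h3 := (abs_lt.mp h1).1
  by_contra hm
  have hm' : (1 : ℝ) ≤ m := by exact_mod_cast (by omega : 1 ≤ m)
  nlinarith

/-- At a far point with ψ = kπ, the angle of order ν lies in (kπ, (k+1)π), and that of order ν + 1
equals kπ, being a multiple of π less than π from ψ. The difference θ - θ' is π/2 + (m - m')π up to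
an error below π/2, and it lies in (0, π), so |m - m'| < 1. -/
lemma HasPhaseShift.eq_of_add_one {ν : ℝ} {θ θ' : ℝ → ℝ} {m m' : ℤ} (hν : -(1 / 2) < ν)
    (hθ : IsPruferPhase ν θ) (h : HasPhaseShift ν θ m) (hθ' : IsPruferPhase (ν + 1) θ')
    (h' : HasPhaseShift (ν + 1) θ' m') : m = m' := by
  have hπ := Real.pi_pos
  obtain ⟨ψ, hψ⟩ := exists_isDerivPhase (ν := ν) (by linarith)
  obtain ⟨X, hX⟩ := eventually_atTop.mp ((eventually_gt_atTop 0).and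
    ((h.eventually_abs_lt (ε := Real.pi / 4) (by linarith)).and
      (h'.eventually_abs_lt (ε := Real.pi / 4) (by linarith))))
  set Y := max X 0
  obtain ⟨k, hk⟩ := exists_nat_gt (ψ Y / Real.pi)
  rw [div_lt_iff₀ hπ] at hk
  obtain ⟨x, hx0, hx⟩ := hψ.exists_eq hν (y := k * Real.pi) (by positivity)
  have hYx : Y < x :=
    (hψ.strictMonoOn.lt_iff_lt (mem_Ici.mpr (le_max_right _ _)) (mem_Ici.mpr hx0)).mp
      (by rw [hx]; exact hk)
  obtain ⟨hxpos, h1, h2⟩ := hX x ((le_max_left _ _).trans hYx.le)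
  have h3 : θ x ∈ Ioo (((k : ℤ) : ℝ) * Real.pi) ((((k : ℤ) : ℝ) + 1) * Real.pi) := by
    refine hθ.mem_Ioo_of_derivPhase hν hψ hxpos ?_
    rw [hx]
    push_cast
    constructor <;> linarith
  have h4 : θ' x = k * Real.pi := by
    have hlt := hθ'.abs_sub_derivPhase_sub_one_lt hν hψ hx0
    obtain ⟨R, hR, e1, -⟩ := hψ.polar x
    have e3 := hθ'.sin x
    have hρ := Real.sqrt_pos.mpr (besselNormSq_pos (ν := ν + 1) (by linarith) x)
    rw [hx, Real.sin_nat_mul_pi, mul_zero, neg_eq_zero, besselEntire'] at e1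
    have hg : x * besselEntire (ν + 1) x = 0 := by
      have : x * (x * besselEntire (ν + 1) x) = 0 := by linear_combination -2 * e1
      exact (mul_eq_zero.mp this).resolve_left hxpos.ne'
    rw [hg] at e3
    obtain ⟨n, hn⟩ := Real.sin_eq_zero_iff.mp
      ((mul_eq_zero.mp e3.symm).resolve_left hρ.ne')
    rw [hx, ← hn, abs_lt] at hlt
    have hn1 : (n : ℝ) < k + 1 := by
      refine lt_of_mul_lt_mul_right (a := Real.pi) ?_ hπ.le
      linarith
    have hn2 : (k : ℝ) < n + 1 := by
      refine lt_of_mul_lt_mul_right (a := Real.pi) ?_ hπ.le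
      linarith
    have hn1' : n < k + 1 := by exact_mod_cast hn1
    have hn2' : (k : ℤ) < n + 1 := by exact_mod_cast hn2
    have : n = k := by omega
    rw [← hn, this]
    push_cast
    ring
  have h5 := h3.1
  have h6 := h3.2
  push_cast at h5 h6
  rw [h4] at h2
  obtain ⟨h7, h8⟩ := abs_lt.mp h1
  obtain ⟨h9, h10⟩ := abs_lt.mp h2
  have hm1 : (m : ℝ) < m' + 1 := by
    refine lt_of_mul_lt_mul_right (a := Real.pi) ?_ hπ.le
    linarith
  have hm2 : (m' : ℝ) < m + 1 := by
    refine lt_of_mul_lt_mul_right (a := Real.pi) ?_ hπ.le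
    linarith
  have hm1' : m < m' + 1 := by exact_mod_cast hm1
  have hm2' : m' < m + 1 := by exact_mod_cast hm2
  omega

/-- Orders above 1/2 descend by steps of 1. For ν ≤ 1/2, m ≥ 0 from order ν meets m ≤ 0 from order ν
+ 1. -/
lemma HasPhaseShift.eq_zero {ν : ℝ} {θ : ℝ → ℝ} {m : ℤ} (hν : -(1 / 2) < ν)
    (hθ : IsPruferPhase ν θ) (h : HasPhaseShift ν θ m) : m = 0 := by
  obtain ⟨n, hn⟩ := exists_nat_ge (ν - 1 / 2)
  induction n generalizing ν θ m with
  | zero =>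
    have hν2 : ν ≤ 1 / 2 := by simpa using hn
    obtain ⟨θ', hθ'⟩ := exists_isPruferPhase (ν := ν + 1) (by linarith)
    obtain ⟨m', h'⟩ := hθ'.exists_hasPhaseShift (by linarith)
    have h1 := h.nonneg hν hν2 hθ
    have h2 := h'.nonpos (by linarith) (by linarith) hθ'
    have h3 := h.eq_of_add_one hν hθ hθ' h'
    omega
  | succ n ih =>
    by_cases hν2 : ν ≤ 1 / 2
    · exact ih hν hθ h (by have : (0 : ℝ) ≤ n := n.cast_nonneg
                           linarith)
    · obtain ⟨θ', hθ'⟩ := exists_isPruferPhase (ν := ν - 1) (by linarith)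
      obtain ⟨m', h'⟩ := hθ'.exists_hasPhaseShift (by linarith)
      have h1 := ih (by linarith) hθ' h' (by push_cast at hn; linarith)
      have e : ν - 1 + 1 = ν := by ring
      have h2 := h'.eq_of_add_one (by linarith) hθ' (θ' := θ) (m' := m) (by rwa [e]) (by rwa [e])
      omega

/-! ### Position of the zeros -/

/-- The zeros of `j_{ν,δ}'` in terms of the phase `ψ`. -/
lemma IsDerivPhase.mem_derivZeros_iff {ν δ x : ℝ} {ψ : ℝ → ℝ} (hν : -1 < ν) (hδ : δ ≤ ν)
    (hψ : IsDerivPhase ν ψ) (hx : 0 ≤ x) : x ∈ derivZeros ν δ ↔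
      ∃ n : ℕ, ψ x = Real.arctan (ν - δ) + ((n + firstIndex ν δ : ℕ) : ℝ) * Real.pi := by
  have hπ := Real.pi_pos
  obtain ⟨R, hR, e1, e2⟩ := hψ.polar x
  set β := ν - δ
  have hβ : 0 ≤ β := by simp only [β]; linarith
  have hat0 : 0 ≤ Real.arctan β := Real.arctan_nonneg.mpr hβ
  have hat1 := Real.arctan_lt_pi_div_two β
  have hcos := Real.cos_arctan_pos β
  have hsin : Real.sin (Real.arctan β) = β * Real.cos (Real.arctan β) := by
    rw [← Real.tan_mul_cos hcos.ne', Real.tan_arctan]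
  have hψpos : 0 < x ↔ 0 < ψ x := by
    rw [← hψ.strictMonoOn.lt_iff_lt (mem_Ici.mpr le_rfl) (mem_Ici.mpr hx), hψ.zero]
  have hzero : x * besselEntire' ν x + β * besselEntire ν x = 0
      ↔ Real.sin (ψ x - Real.arctan β) = 0 := by
    have : R * Real.sin (ψ x - Real.arctan β)
        = -(Real.cos (Real.arctan β)) * (x * besselEntire' ν x + β * besselEntire ν x) := by
      rw [Real.sin_sub, hsin]
      linear_combination -Real.cos (Real.arctan β) * e1 + β * Real.cos (Real.arctan β) * e2
    constructor
    · intro h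
      rw [h, mul_zero] at this
      exact (mul_eq_zero.mp this).resolve_left hR.ne'
    · intro h
      rw [h, mul_zero] at this
      exact (mul_eq_zero.mp this.symm).resolve_left (neg_ne_zero.mpr hcos.ne')
  rw [derivZeros_eq hν, mem_ofPred_eq, hzero, hψpos, Real.sin_eq_zero_iff]
  constructor
  · rintro ⟨hpos, n, hn⟩
    have h1 : (-1 : ℝ) < n := by
      refine lt_of_mul_lt_mul_right (a := Real.pi) ?_ hπ.le
      linarith
    have h1' : -1 < n := by exact_mod_cast h1
    -- When δ = ν the value n = 0 would mean ψ(x) = 0, excluded for x > 0; otherwise n = 0 is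
    -- allowed.
    have h2 : (firstIndex ν δ : ℤ) ≤ n := by
      unfold firstIndex
      split_ifs with h
      · have hβ0 : β = 0 := by simp only [β]; linarith
        rw [hβ0, Real.arctan_zero, sub_zero] at hn
        rw [← hn] at hpos
        have : (0 : ℝ) < n := (pos_iff_pos_of_mul_pos hpos).mpr hπ
        have : 0 < n := by exact_mod_cast this
        omega
      · omega
    obtain ⟨j, hj⟩ := Int.le.dest h2
    refine ⟨j, ?_⟩
    have : (n : ℝ) = ((j + firstIndex ν δ : ℕ) : ℝ) := by
      rw [← hj]; push_cast; ring
    rw [← this]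
    linarith
  · rintro ⟨n, hn⟩
    refine ⟨?_, ((n + firstIndex ν δ : ℕ) : ℤ), by rw [hn]; push_cast; ring⟩
    rw [hn]
    unfold firstIndex
    split_ifs with h
    · positivity
    · have : 0 < Real.arctan β := by
        rw [Real.arctan_pos]
        exact sub_pos.mpr (lt_of_le_of_ne hδ (Ne.symm h))
      positivity

lemma abs_le_abs_tan {x : ℝ} (hx : |x| < Real.pi / 2) : |x| ≤ |Real.tan x| := by
  rcases le_total 0 x with h | h
  · rw [abs_of_nonneg h] at hx ⊢
    exact (Real.le_tan h hx).trans (le_abs_self _)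
  · rw [abs_of_nonpos h] at hx ⊢
    have := Real.le_tan (neg_nonneg.mpr h) hx
    rw [Real.tan_neg] at this
    exact this.trans (neg_le_abs _)

/-- The position of the zero of `j_{ν,δ}'` of index `k`, up to `O(1/x)`. -/
lemma abs_zero_sub_le {ν δ x : ℝ} {ψ : ℝ → ℝ} {k : ℕ} (hν : -(1 / 2) < ν) (hδ : |δ| ≤ ν)
    (hψ : IsDerivPhase ν ψ) (hx : 1 ≤ x) (hxz : x ∈ derivZeros ν δ)
    (hk : ψ x = Real.arctan (ν - δ) + k * Real.pi) :
    |x - Real.pi * (k + ν / 2 + 1 / 4)| ≤ (|ν ^ 2 - 1 / 4| + (ν + 1 / 2)) / x := by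
  have hπ := Real.pi_pos
  have hx0 : 0 < x := by linarith
  obtain ⟨θ, hθ⟩ := exists_isPruferPhase hν
  obtain ⟨m, hm⟩ := hθ.exists_hasPhaseShift hν
  have h1 := hm x hx
  rw [hm.eq_zero hν hθ] at h1
  have hβ : 0 ≤ ν - δ := by linarith [le_of_abs_le hδ]
  have hat0 : 0 ≤ Real.arctan (ν - δ) := Real.arctan_nonneg.mpr hβ
  have hat1 := Real.arctan_lt_pi_div_two (ν - δ)
  have hmem : θ x ∈ Ioo (((k : ℤ) : ℝ) * Real.pi) ((((k : ℤ) : ℝ) + 1) * Real.pi) := by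
    refine hθ.mem_Ioo_of_derivPhase hν hψ hx0 ?_
    rw [hk]
    push_cast
    constructor <;> linarith
  have h2 := hmem.1
  have h3 := hmem.2
  push_cast at h2 h3
  -- Deviation of θ from the midpoint of its interval.
  set φ := θ x - k * Real.pi - Real.pi / 2 with hφ
  have hφlt : |φ| < Real.pi / 2 := by
    rw [abs_lt]; constructor <;> linarith
  have hcos : 0 < Real.cos φ := Real.cos_pos_of_mem_Ioo (abs_lt.mp hφlt)
  -- At the zero, x g' = -(ν - δ) g, so the Prüfer vector is (x g, (δ + 1/2) g) and cot θ = (δ +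
  -- 1/2)/x = -tan φ.
  have htan : Real.tan φ = -(δ + 1 / 2) / x := by
    have hsgn : ((-1 : ℝ) ^ k) * ((-1 : ℝ) ^ k) = 1 := by rw [← mul_pow]; simp
    have eθ : θ x = (φ + Real.pi / 2) + k * Real.pi := by rw [hφ]; ring
    have hρ := Real.sqrt_pos.mpr (besselNormSq_pos hν x)
    have e3 := hθ.sin x
    have e4 := hθ.cos x
    rw [eθ, Real.sin_add_nat_mul_pi, Real.sin_add_pi_div_two] at e3
    rw [eθ, Real.cos_add_nat_mul_pi, Real.cos_add_pi_div_two] at e4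
    set ρ := √(besselNormSq ν x)
    rw [derivZeros_eq (by linarith)] at hxz
    have e5 := hxz.2
    rw [Real.tan_eq_sin_div_cos, div_eq_div_iff hcos.ne' hx0.ne']
    refine mul_left_cancel₀ hρ.ne' ?_
    linear_combination (-1 : ℝ) ^ k * x * e4 - (-1 : ℝ) ^ k * (δ + 1 / 2) * e3
      - (-1 : ℝ) ^ k * x * e5
      + (-ρ * Real.sin φ * x - ρ * (δ + 1 / 2) * Real.cos φ) * hsgn
  have h4 : |φ| ≤ (ν + 1 / 2) / x := by
    refine (abs_le_abs_tan hφlt).trans ?_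
    rw [htan, abs_div, abs_neg, abs_of_pos hx0]
    gcongr
    exact (abs_add_le _ _).trans (add_le_add hδ (by norm_num))
  have e : x - Real.pi * (k + ν / 2 + 1 / 4)
      = φ - (θ x - x - (Real.pi / 4 - Real.pi * ν / 2 + ((0 : ℤ) : ℝ) * Real.pi)) := by
    rw [hφ]; push_cast; ring
  rw [e, add_div]
  exact (abs_sub _ _).trans ((add_le_add h4 h1).trans_eq (add_comm _ _))

end UltraBessel

/-! ### The main theorem -/

open UltraBessel Set in
theorem mainTheorem10 (ν : ℝ) (hν : 0 ≤ ν) :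
    ∃ (C : ℝ) (K : ℕ), ∀ δ : ℝ, |δ| ≤ ν →
      StrictMonoOn (UltraBessel.aPrime ν δ) (Set.Ici (UltraBessel.firstIndex ν δ)) ∧
      UltraBessel.aPrime ν δ '' Set.Ici (UltraBessel.firstIndex ν δ)
        = UltraBessel.derivZeros ν δ ∧
      ∀ k : ℕ, K ≤ k →
        |UltraBessel.aPrime ν δ k - Real.pi * ((k : ℝ) + ν / 2 + 1 / 4)| ≤ C / (k : ℝ) := by
  have hπ := Real.pi_pos
  have hν2 : -(1 / 2) < ν := by linarith
  obtain ⟨ψ, hψ⟩ := exists_isDerivPhase (ν := ν) (by linarith)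
  set D := |ν ^ 2 - 1 / 4| + (ν + 1 / 2)
  have hD : 0 ≤ D := by positivity
  -- k ≥ `K₁` puts the zero beyond 1, where the phase estimate applies; k ≥ `K₂` > `D` gives `b k` ≥
  -- k, turning 1/x into 1/k. Neither depends on δ.
  obtain ⟨K₁, hK₁⟩ := exists_nat_gt (ψ 1)
  obtain ⟨K₂, hK₂⟩ := exists_nat_gt D
  refine ⟨D, max (max K₁ K₂) 1, fun δ hδ ↦ ?_⟩
  have hδν : δ ≤ ν := le_of_abs_le hδ
  have hat0 : 0 ≤ Real.arctan (ν - δ) := Real.arctan_nonneg.mpr (by linarith)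
  have hex : ∀ k : ℕ, ∃ x, 0 ≤ x ∧ ψ x = Real.arctan (ν - δ) + (k : ℝ) * Real.pi :=
    fun k ↦ hψ.exists_eq hν2 (by positivity)
  choose b hb0 hb using hex
  have hbmono : StrictMono b := fun i j hij ↦ by
    refine (hψ.strictMonoOn.lt_iff_lt (mem_Ici.mpr (hb0 i)) (mem_Ici.mpr (hb0 j))).mp ?_
    rw [hb, hb]
    gcongr
  set k₀ := firstIndex ν δ
  have hS : derivZeros ν δ = range fun n ↦ b (n + k₀) := by
    ext x
    constructor
    · intro hx
      have hx0 : 0 ≤ x := le_of_lt hx.1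
      obtain ⟨n, hn⟩ := (hψ.mem_derivZeros_iff (by linarith) hδν hx0).mp hx
      refine ⟨n, hψ.strictMonoOn.injOn (mem_Ici.mpr (hb0 _)) (mem_Ici.mpr hx0) ?_⟩
      rw [hb, hn]
    · rintro ⟨n, rfl⟩
      exact (hψ.mem_derivZeros_iff (by linarith) hδν (hb0 _)).mpr ⟨n, hb _⟩
  have ha : ∀ k, k₀ ≤ k → aPrime ν δ k = b k := by
    intro k hk
    rw [aPrime, hS, increasingList_range (fun i j hij ↦ hbmono (by omega))]
    congr 1
    omega
  refine ⟨fun i hi j hj hij ↦ ?_, ?_, fun k hk ↦ ?_⟩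
  · rw [ha i hi, ha j hj]
    exact hbmono hij
  · rw [hS]
    ext x
    constructor
    · rintro ⟨k, hk, rfl⟩
      have hk : k₀ ≤ k := hk
      exact ⟨k - k₀, by rw [ha k hk]; simp only [Nat.sub_add_cancel hk]⟩
    · rintro ⟨n, rfl⟩
      exact ⟨n + k₀, mem_Ici.mpr (Nat.le_add_left _ _), ha _ (Nat.le_add_left _ _)⟩
  · have hk1 : 1 ≤ k := (le_max_right _ _).trans hk
    have hkk₀ : k₀ ≤ k := by
      refine le_trans ?_ hk1
      simp only [k₀, firstIndex]
      split_ifs <;> omega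
    have hkK₁ : (K₁ : ℝ) ≤ k := by
      exact_mod_cast (le_max_left _ _).trans ((le_max_left _ _).trans hk)
    have hkK₂ : (K₂ : ℝ) ≤ k := by
      exact_mod_cast (le_max_right _ _).trans ((le_max_left _ _).trans hk)
    have hkpos : (0 : ℝ) < k := by exact_mod_cast hk1
    have hkπ : (k : ℝ) * 3 ≤ k * Real.pi := by
      have := Real.pi_gt_three
      gcongr
    rw [ha k hkk₀]
    have hb1 : 1 ≤ b k := by
      refine ((hψ.strictMonoOn.lt_iff_lt (mem_Ici.mpr zero_le_one) (mem_Ici.mpr (hb0 k))).mp ?_).le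
      rw [hb]
      linarith
    have hmem : b k ∈ derivZeros ν δ := by
      rw [hS]; exact ⟨k - k₀, by simp only [Nat.sub_add_cancel hkk₀]⟩
    have hmain := abs_zero_sub_le hν2 hδ hψ hb1 hmem (hb k)
    -- The zero is within `D` < k of a point that is at least πk ≥ 3k.
    have hle : (k : ℝ) ≤ b k := by
      have h1 : -D ≤ _ := neg_le_of_abs_le (hmain.trans (div_le_self hD hb1))
      have h2 : 0 ≤ Real.pi * (ν / 2 + 1 / 4) := by positivity
      linarith
    refine hmain.trans ?_
    gcongr
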